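/- Let $G=(V,E)$ be a finite simple graph with $n$ vertices and maximal degree $\Delta$, let $\varepsilon>0$ be a real number with $(1+\varepsilon)\Delta\ge\Delta+2$, and let $k=\lceil(1+\varepsilon)\Delta\rceil$. A coloring $\sigma:V\to[k]$ is *proper* if it has no monochromatic edge, and *singly-flawed* if it has at least one monochromatic edge and some vertex lies on all of its monochromatic edges; $\mathcal C_p$ and $\mathcal C_{sf}$ are the sets of these colorings. The Single-Flaw dynamics $\mathcal M(G,\varepsilon)$ is the Markov chain on $\Omega=\mathcal C_p\cup\mathcal C_{sf}$ which, with probability $1/2$, does nothing, and otherwise chooses $v\in V$ and $c\in[k]$ uniformly at random and recolors $v$ with $c$ if the result lies in $\Omega$. Let $P$ be its transition matrix, $\pi$ its stationary distribution, and $F=\{(\sigma,\sigma'):P(\sigma,\sigma')>0\}$. A *flow* assigns to every path $p$ in a finite set $\mathcal P_{\alpha\beta}$ of (not necessarily simple) directed paths from $\alpha$ to $\beta$ in $(\Omega,F)$, for all $\alpha,\beta\in\Omega$, a number $f(p)\ge 0$ with $\sum_{p\in\mathcal P_{\alpha\beta}}f(p)=\pi(\alpha)\pi(\beta)$. Its congestion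 on $t=(\sigma,\sigma')\in F$ is $$\rho_f(t)=\frac{1}{\pi(\sigma)P(\sigma,\sigma')}\sum_{\alpha,\beta\in\Omega}\ \sum_{p\in\mathcal P_{\alpha\beta}:\,t\in p}f(p)\,|p|,$$ where $|p|$ is the number of edges of $p$ with multiplicity. For a linear ordering $L$ of $V$ (a bijection $V\to\{1,\dots,n\}$) and $1\le j\le n$, let $S_j$ be the minimal set of vertices at positions greater than $j$ such that no edge joins a vertex at a position at most $j$ to a vertex at a position greater than $j$ outside $S_j$. Let $\mathrm{vsn}(G)=\min_L\max_j|S_j|$, call $L$ *minimal* if it attains the minimum, let $\lambda=\mathrm{vsn}(G)/\log n$ ($\log$ is the natural logarithm), and let $\mathrm{pw}(G)$ be the pathwidth of $G$. Given a minimal order $L$ and $\alpha,\beta\in\mathcal C_p$, the *split canonical paths* from $\alpha$ to $\beta$ consist of $n$ phases. In phase $j$, first the $j$-th vertex is recolored with its color in $\beta$; then, for each $u\in S_j$ in the order $L$, $u$ is recolored with a color available to it (one that no neighbor of $u$ currently has). Recolorings with the same color count as steps, and at each such splitting step the flow entering a state is divided evenly among all colors available to $u$. Given a map $g':\mathcal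 C_{sf}\to\mathcal C_p$ such that each $g'(\sigma)$ arises from $\sigma$ by recoloring a single vertex, the flow between arbitrary $\alpha,\beta\in\Omega$ uses the transition $(\alpha,g'(\alpha))$ first if $\alpha\in\mathcal C_{sf}$, then the split canonical paths between the proper colorings so reached, and the transition $(g'(\beta),\beta)$ last if $\beta\in\mathcal C_{sf}$; the total amount is $\pi(\alpha)\pi(\beta)$. **Main Lemma.** A minimal order $L$ and a map $g'$ as above exist. For every minimal order $L$ and every such map $g'$, each proper coloring has at most $kn$ preimages under $g'$; the assignment $f$ just described is a flow on $(\Omega,F)$; and for every transition $t\in F$, $$\rho_f(t)\le 8k^3(\lambda+1)n^5\log n\left(\frac{1+\varepsilon}{\varepsilon}\right)^{2\,\mathrm{pw}(G)}\quad\text{and}\quad\rho_f(t)\le 8\,\mathrm{pw}(G)\,k^3n^5\left(\frac{1+\varepsilon}{\varepsilon}\right)^{2\,\mathrm{pw}(G)}.$$ -/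

import Mathlib

noncomputable section

namespace SingleFlaw

/-! ### Colorings -/

section Colorings

variable {V : Type*} (G : SimpleGraph V) {k : ℕ}

/-- The set of monochromatic edges of a (not necessarily proper) coloring. -/
def mono (σ : V → Fin k) : Set (Sym2 V) := {e | e ∈ G.edgeSet ∧ (e.map σ).IsDiag}

/-- Proper colorings: no monochromatic edge. -/
def IsProper (σ : V → Fin k) : Prop := mono G σ = ∅

/-- Singly-flawed colorings: there is a monochromatic edge, and some vertex lies on all of them. -/
def IsSinglyFlawed (σ : V → Fin k) : Prop :=
  (mono G σ).Nonempty ∧ ∃ v, ∀ e ∈ mono G σ, v ∈ e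

/-- The proper `k`-colorings of `G`. -/
abbrev ProperColoring (k : ℕ) : Type _ := {σ : V → Fin k // IsProper G σ}

/-- The singly-flawed `k`-colorings of `G`. -/
abbrev SinglyFlawedColoring (k : ℕ) : Type _ := {σ : V → Fin k // IsSinglyFlawed G σ}

/-- The state space: all proper and all singly-flawed `k`-colorings of `G`. -/
abbrev State (k : ℕ) : Type _ := {σ : V → Fin k // IsProper G σ ∨ IsSinglyFlawed G σ}

instance [Finite V] : Fintype (State G k) := Fintype.ofFinite _

variable {G} in
/-- A proper coloring as a state. -/
def ProperColoring.toState (σ : ProperColoring G k) : State G k := ⟨σ.1, Or.inl σ.2⟩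

open Classical in
/-- The colors available to `v` in `σ`: those carried by no neighbour of `v`. -/
def available (σ : V → Fin k) (v : V) : Finset (Fin k) :=
  Finset.univ.filter fun c => ∀ u, G.Adj v u → σ u ≠ c

end Colorings

/-! ### The Single-Flaw dynamics -/

section Dynamics

variable {V : Type*} [Fintype V] [DecidableEq V] (G : SimpleGraph V)

/-- The number of colors, `⌈(1 + ε)Δ⌉`. -/
def numColors [DecidableRel G.Adj] (ε : ℝ) : ℕ := ⌈(1 + ε) * (G.maxDegree : ℝ)⌉₊

variable {k : ℕ}

open Classical in
/-- Recolor `v` with `c` if the result is a state, otherwise do not move. -/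
def move (σ : State G k) (v : V) (c : Fin k) : State G k :=
  if h : IsProper G (Function.update σ.1 v c) ∨ IsSinglyFlawed G (Function.update σ.1 v c)
  then ⟨Function.update σ.1 v c, h⟩ else σ

/-- The transition matrix: with probability `1/2` do nothing, otherwise choose a vertex and a color
uniformly at random and try to recolor. -/
def transition (k : ℕ) : Matrix (State G k) (State G k) ℝ := fun σ τ =>
  1 / 2 * (if τ = σ then 1 else 0) +
    1 / 2 * ∑ v : V, ∑ c : Fin k,
      1 / ((Fintype.card V : ℝ) * (k : ℝ)) * (if τ = move G σ v c then 1 else 0)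

end Dynamics

/-! ### Multicommodity flows on the underlying graph of a finite Markov chain -/

section Flows

variable {Ω : Type*} [Fintype Ω] [DecidableEq Ω] (P : Matrix Ω Ω ℝ) (π : Ω → ℝ)

/-- `π` is a stationary probability distribution of `P`. -/
def IsStationary : Prop :=
  (∀ σ, 0 ≤ π σ) ∧ ∑ σ, π σ = 1 ∧ Matrix.vecMul π P = π

/-- A directed, not necessarily simple, path from `α` to `β` in the graph of all transitions of
positive probability (loops included), given by the list of its states. -/
def IsPath (α β : Ω) (p : List Ω) : Prop :=
  p.head? = some α ∧ p.getLast? = some β ∧ p.IsChain (fun σ τ => 0 < P σ τ)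

/-- The list of edges traversed by a path. -/
def pathEdges (p : List Ω) : List (Ω × Ω) := p.zip p.tail

/-- `f` is a flow along the sets of paths `paths α β`: it is nonnegative, and carries a total of
`π α * π β` from `α` to `β`. The value of `f` on `p ∈ paths α β` is written `f α β p`; the endpoints
`α`, `β` are determined by `p`. -/
def IsFlow (paths : Ω → Ω → Finset (List Ω)) (f : Ω → Ω → List Ω → ℝ) : Prop :=
  (∀ α β, ∀ p ∈ paths α β, IsPath P α β p) ∧
  (∀ α β, ∀ p ∈ paths α β, 0 ≤ f α β p) ∧
  (∀ α β, ∑ p ∈ paths α β, f α β p = π α * π β)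

/-- The congestion of the transition `t`:
`1 / q t` times the sum of `f p * |p|` over all paths `p` through `t`, with `q t = π t.1 * P t.1 t.2`
the ergodic flow and `|p|` the number of edges of `p`, with multiplicity. -/
def congestion (paths : Ω → Ω → Finset (List Ω)) (f : Ω → Ω → List Ω → ℝ) (t : Ω × Ω) : ℝ :=
  1 / (π t.1 * P t.1 t.2) *
    ∑ α, ∑ β, ∑ p ∈ (paths α β).filter (fun p => t ∈ pathEdges p),
      f α β p * ((p.length : ℝ) - 1)

end Flows

/-! ### Pathwidth and vertex separation -/

section Width

variable {V : Type*} [Fintype V] (G : SimpleGraph V)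

/-- Path decompositions, with bags `X 0, …, X (m - 1)` along the path. -/
structure IsPathDecomposition {m : ℕ} (X : Fin m → Finset V) : Prop where
  cover : ∀ v, ∃ i, v ∈ X i
  edge : ∀ u v, G.Adj u v → ∃ i, u ∈ X i ∧ v ∈ X i
  interval : ∀ (i j l : Fin m), i ≤ j → j ≤ l → ∀ v, v ∈ X i → v ∈ X l → v ∈ X j

/-- The width of a family of bags: the largest bag size minus one. -/
def width {m : ℕ} (X : Fin m → Finset V) : ℕ := Finset.univ.sup fun i => (X i).card - 1

/-- The pathwidth of a graph. -/
def pathwidth : ℕ :=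
  sInf {w | ∃ (m : ℕ) (X : Fin m → Finset V), IsPathDecomposition G X ∧ width X = w}

/-- Linear orderings of the vertices; positions are counted from `0`. -/
abbrev LinOrd (V : Type*) [Fintype V] : Type _ := V ≃ Fin (Fintype.card V)

/-- `S` lies after position `j` and separates the vertices up to position `j` from the other
vertices after position `j`. -/
def IsVertexSeparator (L : LinOrd V) (j : Fin (Fintype.card V)) (S : Finset V) : Prop :=
  (∀ u ∈ S, j < L u) ∧ ∀ u v, L u ≤ j → j < L v → v ∉ S → ¬ G.Adj u v

open Classical in
/-- The minimal vertex separator for `j`: see `minimal_isVertexSeparator_iff`. -/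
def mvs (L : LinOrd V) (j : Fin (Fintype.card V)) : Finset V :=
  Finset.univ.filter fun v => j < L v ∧ ∃ u, L u ≤ j ∧ G.Adj u v

theorem minimal_isVertexSeparator_iff (L : LinOrd V) (j : Fin (Fintype.card V)) (S : Finset V) :
    Minimal (IsVertexSeparator G L j) S ↔ S = mvs G L j := by
  have h1 : IsVertexSeparator G L j (mvs G L j) := by
    refine ⟨fun u hu => ?_, fun u v hu hv hvS hadj => hvS ?_⟩
    · simp only [mvs, Finset.mem_filter] at hu
      exact hu.2.1
    · simp only [mvs, Finset.mem_filter, Finset.mem_univ, true_and]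
      exact ⟨hv, u, hu, hadj⟩
  have h2 : ∀ T, IsVertexSeparator G L j T → mvs G L j ⊆ T := by
    intro T hT v hv
    simp only [mvs, Finset.mem_filter, Finset.mem_univ, true_and] at hv
    obtain ⟨hv, u, hu, hadj⟩ := hv
    by_contra hvT
    exact hT.2 u v hu hv hvT hadj
  constructor
  · intro hS
    exact Finset.Subset.antisymm (hS.2 h1 (h2 S hS.1)) (h2 S hS.1)
  · rintro rfl
    exact ⟨h1, fun T hT _ => h2 T hT⟩

/-- The vertex separation number of `G` with respect to a linear ordering. -/
def vsnOrder (L : LinOrd V) : ℕ := Finset.univ.sup fun j => (mvs G L j).card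

/-- The vertex separation number of `G`. -/
def vsn : ℕ := ⨅ L : LinOrd V, vsnOrder G L

/-- Minimal orders: those attaining the vertex separation number. -/
def IsMinimalOrder (L : LinOrd V) : Prop := vsnOrder G L = vsn G

end Width

/-! ### The split canonical paths -/

section CanonicalPaths

variable {V : Type*} [Fintype V] [DecidableEq V] (G : SimpleGraph V) {k : ℕ}

/-- The steps of canonical paths: `fix v` gives `v` its final color, `split u` recolors `u` with
any of its available colors. -/
inductive Step (V : Type*) where
  | fix (v : V) : Step V
  | split (u : V) : Step V

/-- Phase `j`: fix the vertex at position `j`, then split at all vertices of the minimal vertex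
separator for `j`, in order. -/
def phase (L : LinOrd V) (j : Fin (Fintype.card V)) : List (Step V) :=
  Step.fix (L.symm j) ::
    ((((List.finRange (Fintype.card V)).map L.symm).filter (fun u => u ∈ mvs G L j)).map Step.split)

/-- All phases, one after the other. -/
def schedule (L : LinOrd V) : List (Step V) :=
  (List.finRange (Fintype.card V)).flatMap (phase G L)

/-- `τ` is a possible successor of `σ` at the given step, on the way to `β`. -/
def IsSucc (β : State G k) (σ : State G k) (τ : State G k) : Step V → Prop
  | Step.fix v => τ.1 = Function.update σ.1 v (β.1 v)
  | Step.split u => ∃ c ∈ available G σ.1 u, τ.1 = Function.update σ.1 u c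

open Classical in
/-- The paths starting at a given state that carry out the given list of steps towards `β`. -/
def stepPaths (β : State G k) : List (Step V) → State G k → Finset (List (State G k))
  | [], σ => {[σ]}
  | s :: l, σ =>
      (Finset.univ.filter fun τ => IsSucc G β σ τ s).biUnion
        fun τ => (stepPaths β l τ).image (List.cons σ)

/-- The fraction of the flow that is routed along a given path, when at every splitting step the
flow entering a state is divided evenly among the available colors. -/
def splitWeight : List (Step V) → List (State G k) → ℝ
  | Step.fix _ :: l, _ :: p => splitWeight l p
  | Step.split u :: l, σ :: p => ((available G σ.1 u).card : ℝ)⁻¹ * splitWeight l p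
  | _, _ => 1

/-- `g` sends every singly-flawed coloring to a proper coloring obtained from it by recoloring one
vertex. -/
def IsRepair (g : SinglyFlawedColoring G k → ProperColoring G k) : Prop :=
  ∀ σ, ∃ v c, (g σ).1 = Function.update σ.1 v c

open Classical in
/-- The proper coloring through which the flow from (or to) `σ` is routed: `σ` itself if it is
proper, and its image under `g` if it is singly-flawed. -/
def proxy (g : SinglyFlawedColoring G k → ProperColoring G k) (σ : State G k) : State G k :=
  if h : IsProper G σ.1 then σ else (g ⟨σ.1, σ.2.resolve_left h⟩).toState

open Classical in
/-- The flow paths from `α` to `β`: move from `α` to its proxy if `α` is singly-flawed, follow a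
canonical path to the proxy of `β`, and move on to `β` if `β` is singly-flawed. -/
def flowPaths (L : LinOrd V) (g : SinglyFlawedColoring G k → ProperColoring G k)
    (α β : State G k) : Finset (List (State G k)) :=
  (stepPaths G (proxy G g β) (schedule G L) (proxy G g α)).image fun p =>
    (if IsProper G α.1 then [] else [α]) ++ p ++ (if IsProper G β.1 then [] else [β])

open Classical in
/-- The flow along the flow paths: `π α * π β`, evenly split at every splitting step. -/
def splitFlow (π : State G k → ℝ) (L : LinOrd V) (α β : State G k) (p : List (State G k)) : ℝ :=
  π α * π β * splitWeight G (schedule G L) (if IsProper G α.1 then p else p.tail)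

end CanonicalPaths

end SingleFlaw

end

namespace SingleFlaw

noncomputable section

/-! ### Proper and singly-flawed colorings under recoloring -/

section Recoloring

variable {V : Type*} {G : SimpleGraph V} {k : ℕ}

/-! The chain is symmetric and irreducible, so its stationary distribution is uniform on the `N`
states. The congestion of `t` then reduces to counting: how much canonical flow, summed over all
pairs of endpoints, passes through `t`. Replacing an endpoint by its proxy costs a factor `k * n`,
because a one-vertex recoloring can be undone by naming a vertex and a color
(`IsRepair.sum_comp_proxy_le`). It remains to treat proper endpoints.

The canonical paths stay in the state space. After fixing `v` in phase `j`, a monochromatic edge can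
only join `v` to the separator, since earlier neighbors already have their final colors; splitting
at the separator removes these edges one by one (`isSafe_phase`). Hence no flow is lost, and this
also yields irreducibility.

Cut the schedule after `i` steps and fix the current state `σ`. Let `D` be the vertices already
fixed, `A` those last recolored by a split, and `S` a separator of `D` from the rest, with `A ⊆ S`
and at most `vsnOrder G L` elements. Then `σ` shows `β` on `D` and `α` off `D ∪ A`. A pair that
reaches `σ` is therefore determined by the hybrid of `α` on `D` and `β` off `D`, together with `α`
on `A`. The hybrid is proper away from `S`, and repairing it one vertex at a time shows that there
are at most `(k / (k - Δ)) ^ |S|` times as many such hybrids as proper colorings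
(`card_isProperOff_mul_pow_le`). The `k ^ |A|` choices on `A` are offset by splitting: each such
pair sends at most `(k - Δ)⁻¹ ^ |A|` of its flow through `σ` (`reach_le`). Since `|A| ≤ |S|`, the
exponent is at most twice the vertex separation number (`sum_reach_le`).

Finally one sums over the steps that can use `t`. A transition that changes a color fits at most one
step per phase, hence at most `n` steps; a loop may fit every step, but has probability at least `1
/ 2`. Vertex separation is at most pathwidth, and `k / (k - Δ) ≤ (1 + ε) / ε`. -/

theorem mem_mono_iff {σ : V → Fin k} {u v : V} :
    s(u, v) ∈ mono G σ ↔ G.Adj u v ∧ σ u = σ v := by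
  simp [mono]

theorem isProper_iff {σ : V → Fin k} :
    IsProper G σ ↔ ∀ u v, G.Adj u v → σ u ≠ σ v := by
  constructor
  · intro h u v huv he
    have : s(u, v) ∈ mono G σ := mem_mono_iff.2 ⟨huv, he⟩
    rw [IsProper] at h
    simp [h] at this
  · intro h
    refine Set.eq_empty_iff_forall_notMem.2 fun e => ?_
    induction e with
    | _ u v => exact fun he => h u v (mem_mono_iff.1 he).1 (mem_mono_iff.1 he).2

/-- A coloring all of whose monochromatic edges share a vertex is proper or singly-flawed. -/
theorem isProper_or_isSinglyFlawed {σ : V → Fin k} (v : V)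
    (h : ∀ a b, G.Adj a b → σ a = σ b → a = v ∨ b = v) :
    IsProper G σ ∨ IsSinglyFlawed G σ := by
  rcases Set.eq_empty_or_nonempty (mono G σ) with h0 | h0
  · exact Or.inl h0
  · refine Or.inr ⟨h0, v, fun e => ?_⟩
    induction e with
    | _ a b =>
      intro he
      rcases h a b (mem_mono_iff.1 he).1 (mem_mono_iff.1 he).2 with rfl | rfl <;> simp

theorem IsSinglyFlawed.exists_vertex {σ : V → Fin k} (h : IsSinglyFlawed G σ) :
    ∃ v, ∀ a b, G.Adj a b → σ a = σ b → a = v ∨ b = v := by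
  obtain ⟨-, v, hv⟩ := h
  refine ⟨v, fun a b hab he => ?_⟩
  have := hv s(a, b) (mem_mono_iff.2 ⟨hab, he⟩)
  rw [Sym2.mem_iff] at this
  exact this.imp Eq.symm Eq.symm

theorem mem_available {σ : V → Fin k} {v : V} {c : Fin k} :
    c ∈ available G σ v ↔ ∀ u, G.Adj v u → σ u ≠ c := by
  simp [available]

/-- Recoloring with an available color leaves no monochromatic edge at the recolored vertex. -/
theorem mono_update_of_mem_available [DecidableEq V] {σ : V → Fin k} {v : V} {c : Fin k}
    (hc : c ∈ available G σ v) {a b : V} (hab : G.Adj a b)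
    (he : Function.update σ v c a = Function.update σ v c b) :
    a ≠ v ∧ b ≠ v ∧ σ a = σ b := by
  rw [mem_available] at hc
  by_cases ha : a = v
  · subst ha
    have hb : b ≠ a := hab.ne'
    rw [Function.update_self, Function.update_of_ne hb] at he
    exact absurd he.symm (hc b hab)
  · by_cases hb : b = v
    · subst hb
      rw [Function.update_self, Function.update_of_ne ha] at he
      exact absurd he (hc a hab.symm)
    · rw [Function.update_of_ne ha, Function.update_of_ne hb] at he
      exact ⟨ha, hb, he⟩

theorem le_card_available [Fintype V] [DecidableRel G.Adj] (σ : V → Fin k) (v : V) :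
    k - G.maxDegree ≤ (available G σ v).card := by
  classical
  have h : (Finset.univ \ (G.neighborFinset v).image σ) ⊆ available G σ v := by
    intro c hc
    rw [mem_available]
    rintro u hu rfl
    simp only [Finset.mem_sdiff, Finset.mem_univ, true_and, Finset.mem_image, not_exists,
      not_and] at hc
    exact hc u (by simpa using hu) rfl
  have h1 := Finset.card_le_card h
  have h2 : ((G.neighborFinset v).image σ).card ≤ G.maxDegree :=
    Finset.card_image_le.trans (G.degree_le_maxDegree v)
  have h3 := Finset.le_card_sdiff ((G.neighborFinset v).image σ) (Finset.univ : Finset (Fin k))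
  simp only [Finset.card_univ, Fintype.card_fin] at h3
  omega

/-- Recoloring the common vertex of all monochromatic edges with an available color removes all of
them and creates none. -/
theorem exists_isRepair [Fintype V] [DecidableEq V] [DecidableRel G.Adj]
    (hk : G.maxDegree < k) :
    ∃ g : SinglyFlawedColoring G k → ProperColoring G k, IsRepair G g := by
  have key : ∀ σ : SinglyFlawedColoring G k, ∃ τ : ProperColoring G k,
      ∃ v c, τ.1 = Function.update σ.1 v c := by
    rintro ⟨σ, hσ⟩
    obtain ⟨v, hv⟩ := hσ.exists_vertex
    have : 0 < (available G σ v).card := by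
      have := le_card_available (G := G) σ v
      omega
    obtain ⟨c, hc⟩ := Finset.card_pos.1 this
    refine ⟨⟨Function.update σ v c, isProper_iff.2 fun a b hab he => ?_⟩, v, c, rfl⟩
    obtain ⟨ha, hb, he⟩ := mono_update_of_mem_available hc hab he
    rcases hv a b hab he with h | h <;> contradiction
  choose g hg using key
  exact ⟨g, hg⟩

end Recoloring

/-! ### Counting colorings that are proper away from a set -/

section Counting

variable {V : Type*} (G : SimpleGraph V) {k : ℕ}

/-- Colorings without monochromatic edges outside `S`. -/
def IsProperOff (S : Finset V) (η : V → Fin k) : Prop :=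
  ∀ a b, a ∉ S → b ∉ S → G.Adj a b → η a ≠ η b

open Classical in
-- Double counting of pairs of a coloring and a color available at `u`: recoloring `u` removes all
-- flaws at `u`, and remembering the old color of `u`, one of `k`, makes this injective.
theorem card_isProperOff_insert_mul_le [Fintype V] [DecidableEq V] [DecidableRel G.Adj]
    {S : Finset V} {u : V} :
    (Finset.univ.filter fun η : V → Fin k => IsProperOff G (insert u S) η).card *
        (k - G.maxDegree) ≤
      k * (Finset.univ.filter fun η : V → Fin k => IsProperOff G S η).card := by
  set E := Finset.univ.filter fun η : V → Fin k => IsProperOff G (insert u S) η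
  set E' := Finset.univ.filter fun η : V → Fin k => IsProperOff G S η
  calc E.card * (k - G.maxDegree) ≤ ∑ η ∈ E, (available G η u).card := by
        rw [← smul_eq_mul]
        exact Finset.card_nsmul_le_sum _ _ _ fun η _ => le_card_available η u
    _ = (E.sigma fun η => available G η u).card := (Finset.card_sigma _ _).symm
    _ ≤ ((Finset.univ : Finset (Fin k)) ×ˢ E').card := by
        refine Finset.card_le_card_of_injOn (fun x => (x.1 u, Function.update x.1 u x.2)) ?_ ?_
        · rintro ⟨η, c⟩ hx
          simp only [Finset.coe_sigma, Set.mem_sigma_iff, Finset.mem_coe] at hx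
          simp only [Finset.coe_product, Set.mem_prod, Finset.mem_coe, Finset.mem_univ, true_and]
          refine Finset.mem_filter.2 ⟨Finset.mem_univ _, fun a b ha hb hab he => ?_⟩
          obtain ⟨hau, hbu, he⟩ := mono_update_of_mem_available hx.2 hab he
          exact (Finset.mem_filter.1 hx.1).2 a b (by simp [ha, hau]) (by simp [hb, hbu]) hab he
        · rintro ⟨η, c⟩ - ⟨η', c'⟩ - h
          simp only [Prod.mk.injEq] at h
          obtain ⟨h1, h2⟩ := h
          have hη : η = η' := by
            funext w
            by_cases hw : w = u
            · rw [hw, h1]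
            · simpa [hw] using congrFun h2 w
          have hc : c = c' := by simpa using congrFun h2 u
          rw [hη, hc]
    _ = k * E'.card := by simp

open Classical in
theorem card_isProperOff_mul_pow_le [Fintype V] [DecidableEq V] [DecidableRel G.Adj]
    (S : Finset V) :
    (Finset.univ.filter fun η : V → Fin k => IsProperOff G S η).card *
        (k - G.maxDegree) ^ S.card ≤
      (Finset.univ.filter fun η : V → Fin k => IsProper G η).card * k ^ S.card := by
  induction S using Finset.induction_on with
  | empty => simp [IsProperOff, isProper_iff]
  | insert u S hu ih =>
    rw [Finset.card_insert_of_notMem hu, pow_succ', pow_succ', ← mul_assoc]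
    calc _ ≤ _ := Nat.mul_le_mul_right _ (card_isProperOff_insert_mul_le G)
      _ = k * ((Finset.univ.filter fun η : V → Fin k => IsProperOff G S η).card *
          (k - G.maxDegree) ^ S.card) := by ring
      _ ≤ _ := Nat.mul_le_mul_left _ ih
      _ = _ := by ring

open Classical in
/-- Pairs of proper colorings, the second prescribed on `D` and the first prescribed
outside `D ∪ A`, for `S` separating `D` from the other vertices. -/
theorem card_pairs_le [Fintype V] [DecidableEq V] (σ : V → Fin k) (D A S : Finset V)
    (hS : ∀ a b, a ∈ D → b ∉ D → b ∉ S → ¬ G.Adj a b) :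
    (Finset.univ.filter fun x : (V → Fin k) × (V → Fin k) =>
        IsProper G x.1 ∧ IsProper G x.2 ∧ (∀ v ∈ D, x.2 v = σ v) ∧
          ∀ v, v ∉ D → v ∉ A → x.1 v = σ v).card ≤
      (Finset.univ.filter fun η : V → Fin k => IsProperOff G S η).card * k ^ A.card := by
  have hA : (Finset.univ : Finset (A → Fin k)).card = k ^ A.card := by simp
  rw [← hA, ← Finset.card_product]
  -- The hybrid takes the first coloring on `D` and the second off `D`. Both are proper, so a
  -- monochromatic edge must cross the boundary of `D` and hence meet `S`. The hybrid loses the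
  -- first coloring off `D`, which is prescribed outside `A` and recorded separately on `A`.
  refine Finset.card_le_card_of_injOn
    (fun x => (fun v => if v ∈ D then x.1 v else x.2 v, fun v => x.1 v)) ?_ ?_
  · rintro ⟨α, β⟩ hx
    obtain ⟨hα, hβ, -, -⟩ := (Finset.mem_filter.1 hx).2
    rw [isProper_iff] at hα hβ
    simp only [Finset.coe_product, Set.mem_prod, Finset.mem_coe, Finset.mem_univ, and_true]
    refine Finset.mem_filter.2 ⟨Finset.mem_univ _, fun a b ha hb hab => ?_⟩
    by_cases haD : a ∈ D <;> by_cases hbD : b ∈ D <;> simp only [haD, hbD, if_true, if_false]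
    · exact hα a b hab
    · exact absurd hab (hS a b haD hbD hb)
    · exact absurd hab.symm (hS b a hbD haD ha)
    · exact hβ a b hab
  · rintro ⟨α, β⟩ hx ⟨α', β'⟩ hx' h
    obtain ⟨-, -, h1, h2⟩ := (Finset.mem_filter.1 hx).2
    obtain ⟨-, -, h1', h2'⟩ := (Finset.mem_filter.1 hx').2
    simp only [Prod.mk.injEq] at h h1 h2 h1' h2'
    obtain ⟨h3, h4⟩ := h
    refine Prod.ext (funext fun v => ?_) (funext fun v => ?_)
    · by_cases hD : v ∈ D
      · simpa [hD] using congrFun h3 v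
      · by_cases hvA : v ∈ A
        · exact congrFun h4 ⟨v, hvA⟩
        · simp [h2 v hD hvA, h2' v hD hvA]
    · by_cases hD : v ∈ D
      · simp [h1 v hD, h1' v hD]
      · simpa [hD] using congrFun h3 v

end Counting

/-! ### Vertex separation and pathwidth -/

section Orders

variable {V : Type*} [Fintype V] (G : SimpleGraph V)

theorem exists_isMinimalOrder : ∃ L : LinOrd V, IsMinimalOrder G L := by
  have : Nonempty (LinOrd V) := ⟨Fintype.equivFin V⟩
  obtain ⟨L, hL⟩ := Nat.sInf_mem (Set.range_nonempty (vsnOrder G))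
  exact ⟨L, hL⟩

theorem mem_mvs {L : LinOrd V} {j : Fin (Fintype.card V)} {v : V} :
    v ∈ mvs G L j ↔ j < L v ∧ ∃ u, L u ≤ j ∧ G.Adj u v := by
  simp [mvs]

/-- Ordering the vertices by the last bag that contains them yields separators inside bags. -/
theorem IsPathDecomposition.exists_vsnOrder_le {m : ℕ} {X : Fin m → Finset V}
    (h : IsPathDecomposition G X) : ∃ L : LinOrd V, vsnOrder G L ≤ width X := by
  classical
  have hlast : ∀ v, ∃ i, v ∈ X i ∧ ∀ l, v ∈ X l → l ≤ i := by
    intro v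
    obtain ⟨i, hi⟩ := h.cover v
    have hne : (Finset.univ.filter fun i => v ∈ X i).Nonempty := ⟨i, by simpa using hi⟩
    refine ⟨_, (Finset.mem_filter.1 (Finset.max'_mem _ hne)).2, fun l hl => ?_⟩
    exact Finset.le_max' _ _ (by simpa using hl)
  choose last hmem hmax using hlast
  let e := Fintype.equivFin V
  let s := Tuple.sort (last ∘ e.symm)
  have hs : Monotone ((last ∘ e.symm) ∘ s) := Tuple.monotone_sort _
  let L : LinOrd V := e.trans s.symm
  have hL : ∀ u v, L u ≤ L v → last u ≤ last v := by
    intro u v huv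
    have := hs huv
    simpa [L] using this
  refine ⟨L, Finset.sup_le fun j _ => ?_⟩
  set w := L.symm j
  have hw : L w = j := L.apply_symm_apply j
  -- A separator vertex `v` shares a bag `l` with some `u` at or before `w`, so `l ≤ last u ≤ last w
  -- ≤ last v`, and the interval property puts `v` in the last bag of `w`. Removing `w` itself from
  -- that bag accounts for the `- 1` in the width.
  have hsub : mvs G L j ⊆ (X (last w)).erase w := by
    intro v hv
    obtain ⟨hjv, u, hu, huv⟩ := (mem_mvs G).1 hv
    rw [Finset.mem_erase]
    refine ⟨fun hvw => by rw [hvw, hw] at hjv; exact lt_irrefl _ hjv, ?_⟩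
    obtain ⟨l, hul, hvl⟩ := h.edge u v huv
    refine h.interval l (last w) (last v) ?_ ?_ v hvl (hmem v)
    · exact (hmax u l hul).trans (hL u w (by rwa [hw]))
    · exact hL w v (by rw [hw]; exact hjv.le)
  calc (mvs G L j).card ≤ ((X (last w)).erase w).card := Finset.card_le_card hsub
    _ = (X (last w)).card - 1 := Finset.card_erase_of_mem (hmem w)
    _ ≤ width X := Finset.le_sup (f := fun i => (X i).card - 1) (Finset.mem_univ (last w))

theorem vsn_le_pathwidth : vsn G ≤ pathwidth G := by
  -- The single bag of all vertices is a decomposition, so the infimum is attained and is not the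
  -- default value `0` of an empty infimum.
  have hne : {w | ∃ (m : ℕ) (X : Fin m → Finset V),
      IsPathDecomposition G X ∧ width X = w}.Nonempty :=
    ⟨_, 1, fun _ => Finset.univ, ⟨fun v => ⟨0, by simp⟩, fun u v _ => ⟨0, by simp⟩,
      by simp⟩, rfl⟩
  obtain ⟨m, X, hX, hw⟩ := Nat.sInf_mem hne
  obtain ⟨L, hL⟩ := hX.exists_vsnOrder_le
  calc vsn G ≤ vsnOrder G L := ciInf_le (OrderBot.bddBelow _) L
    _ ≤ width X := hL
    _ = pathwidth G := hw

theorem card_mvs_le (L : LinOrd V) (j : Fin (Fintype.card V)) :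
    (mvs G L j).card ≤ vsnOrder G L :=
  Finset.le_sup (f := fun j => (mvs G L j).card) (Finset.mem_univ j)

/-- The later endpoint of an edge lies in the separator at the earlier one. Positivity is needed to
absorb the additive terms of the path length into a multiple of the separation number. -/
theorem vsnOrder_pos (L : LinOrd V) {a b : V} (hab : G.Adj a b) : 0 < vsnOrder G L := by
  wlog h : L a < L b generalizing a b
  · refine this hab.symm (lt_of_le_of_ne (not_lt.1 h) fun he => hab.ne (L.injective he).symm)
  exact lt_of_lt_of_le (Finset.card_pos.2 ⟨b, (mem_mvs G).2 ⟨h, a, le_rfl, hab⟩⟩)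
    (card_mvs_le G L (L a))

theorem vsnOrder_le_card (L : LinOrd V) : vsnOrder G L ≤ Fintype.card V :=
  Finset.sup_le fun _ _ => Finset.card_le_univ _

end Orders

/-! ### The transition matrix -/

section Chain

variable {V : Type*} [DecidableEq V] (G : SimpleGraph V) {k : ℕ}

variable {G} in
theorem move_eq_of_eq_update {σ τ : State G k} {v : V} {c : Fin k}
    (h : τ.1 = Function.update σ.1 v c) : move G σ v c = τ := by
  have h' : IsProper G (Function.update σ.1 v c) ∨ IsSinglyFlawed G (Function.update σ.1 v c) :=
    h ▸ τ.2
  rw [move, dif_pos h']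
  exact Subtype.ext h.symm

variable {G} in
theorem move_eq_iff_of_ne {σ τ : State G k} (hne : τ ≠ σ) {v : V} {c : Fin k} :
    τ = move G σ v c ↔ τ.1 = Function.update σ.1 v c := by
  refine ⟨fun h => ?_, fun h => (move_eq_of_eq_update h).symm⟩
  rw [move] at h
  split_ifs at h with hs
  · rw [h]
  · exact absurd h hne

variable [Fintype V]

theorem transition_nonneg (σ τ : State G k) : 0 ≤ transition G k σ τ := by
  unfold transition
  positivity

theorem half_le_transition_self (σ : State G k) : 1 / 2 ≤ transition G k σ σ := by
  unfold transition
  rw [if_pos rfl, mul_one]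
  exact le_add_of_nonneg_right (by positivity)

variable {G} in
theorem le_transition_of_eq_update {σ τ : State G k} {v : V} {c : Fin k}
    (h : τ.1 = Function.update σ.1 v c) :
    1 / 2 * (1 / ((Fintype.card V : ℝ) * (k : ℝ))) ≤ transition G k σ τ := by
  unfold transition
  have h1 : (1 : ℝ) / ((Fintype.card V : ℝ) * (k : ℝ)) ≤ ∑ v : V, ∑ c : Fin k,
      1 / ((Fintype.card V : ℝ) * (k : ℝ)) * (if τ = move G σ v c then 1 else 0) := by
    calc (1 : ℝ) / ((Fintype.card V : ℝ) * (k : ℝ))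
        = 1 / ((Fintype.card V : ℝ) * (k : ℝ)) * (if τ = move G σ v c then 1 else 0) := by
          rw [if_pos (move_eq_of_eq_update h).symm, mul_one]
      _ ≤ ∑ c : Fin k,
          1 / ((Fintype.card V : ℝ) * (k : ℝ)) * (if τ = move G σ v c then 1 else 0) :=
          Finset.single_le_sum (f := fun c => 1 / ((Fintype.card V : ℝ) * (k : ℝ)) *
            (if τ = move G σ v c then (1 : ℝ) else 0)) (fun _ _ => by positivity)
            (Finset.mem_univ c)
      _ ≤ _ := Finset.single_le_sum (f := fun v => ∑ c : Fin k,
            1 / ((Fintype.card V : ℝ) * (k : ℝ)) *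
            (if τ = move G σ v c then (1 : ℝ) else 0)) (fun _ _ => by positivity)
            (Finset.mem_univ v)
  have h2 : (0 : ℝ) ≤ 1 / 2 * (if τ = σ then 1 else 0) := by positivity
  linarith

variable {G} in
theorem transition_pos_of_eq_update {σ τ : State G k} {v : V} {c : Fin k}
    (h : τ.1 = Function.update σ.1 v c) : 0 < transition G k σ τ := by
  refine lt_of_lt_of_le ?_ (le_transition_of_eq_update h)
  have : 0 < Fintype.card V := Fintype.card_pos_iff.2 ⟨v⟩
  have : 0 < k := c.pos
  positivity

variable {G} in
theorem exists_eq_update_of_transition_pos {σ τ : State G k} (hne : τ ≠ σ)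
    (h : 0 < transition G k σ τ) : ∃ v c, τ.1 = Function.update σ.1 v c := by
  by_contra! hcon
  have : transition G k σ τ = 0 := by
    unfold transition
    rw [if_neg hne, mul_zero, zero_add]
    simp [move_eq_iff_of_ne hne, hcon]
  exact h.ne' this

theorem sum_transition [Nonempty V] (hk : 0 < k) (σ : State G k) :
    ∑ τ, transition G k σ τ = 1 := by
  have hn : (Fintype.card V : ℝ) ≠ 0 := by exact_mod_cast Fintype.card_ne_zero
  have hk' : (k : ℝ) ≠ 0 := by exact_mod_cast hk.ne'
  unfold transition
  rw [Finset.sum_add_distrib, ← Finset.mul_sum, ← Finset.mul_sum, Finset.sum_comm]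
  have : ∀ v : V, ∑ τ : State G k, ∑ c : Fin k,
      1 / ((Fintype.card V : ℝ) * (k : ℝ)) * (if τ = move G σ v c then 1 else 0) =
      ∑ c : Fin k, 1 / ((Fintype.card V : ℝ) * (k : ℝ)) := by
    intro v
    rw [Finset.sum_comm]
    refine Finset.sum_congr rfl fun c _ => ?_
    rw [← Finset.mul_sum]
    simp
  simp only [this]
  simp
  field_simp
  norm_num

theorem transition_symm (σ τ : State G k) : transition G k σ τ = transition G k τ σ := by
  classical
  by_cases hne : τ = σ
  · rw [hne]
  -- For a given `v`, only the color `τ.1 v` can lead from `σ` to `τ`, and it does so exactly when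
  -- the two agree off `v`, a condition symmetric in `σ` and `τ`.
  have key : ∀ (σ τ : State G k), τ ≠ σ → ∀ v, ∑ c : Fin k,
      1 / ((Fintype.card V : ℝ) * (k : ℝ)) * (if τ = move G σ v c then (1 : ℝ) else 0) =
      1 / ((Fintype.card V : ℝ) * (k : ℝ)) *
        (if ∀ w, w ≠ v → τ.1 w = σ.1 w then (1 : ℝ) else 0) := by
    intro σ τ hne v
    rw [← Finset.mul_sum]
    congr 1
    trans ∑ c : Fin k, if c = τ.1 v then
      (if ∀ w, w ≠ v → τ.1 w = σ.1 w then (1 : ℝ) else 0) else 0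
    swap
    · simp
    simp only [← ite_and]
    refine Finset.sum_congr rfl fun c _ => ?_
    refine if_congr ?_ rfl rfl
    rw [move_eq_iff_of_ne hne]
    constructor
    · intro h
      rw [h]
      exact ⟨by simp, fun w hw => by simp [hw]⟩
    · rintro ⟨rfl, h⟩
      exact Function.eq_update_iff.2 ⟨rfl, h⟩
  unfold transition
  rw [if_neg hne, if_neg (Ne.symm hne)]
  simp only [key σ τ hne, key τ σ (Ne.symm hne), eq_comm]

end Chain

/-! ### Uniformity of the stationary distribution -/

section Stationary

variable {Ω : Type*} {P : Matrix Ω Ω ℝ} {π : Ω → ℝ}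

/-- The stationary distribution of an irreducible symmetric chain is uniform. -/
theorem IsStationary.eq_inv_card [Fintype Ω] (hP : ∀ σ τ, 0 ≤ P σ τ) (hrow : ∀ σ, ∑ τ, P σ τ = 1)
    (hsymm : ∀ σ τ, P σ τ = P τ σ)
    (hirr : ∀ α β, Relation.ReflTransGen (fun σ τ => 0 < P σ τ) α β)
    (hπ : IsStationary P π) (σ : Ω) : π σ = (Fintype.card Ω : ℝ)⁻¹ := by
  obtain ⟨-, hsum, hst⟩ := hπ
  have : Nonempty Ω := ⟨σ⟩
  obtain ⟨μ, hμ⟩ := Finite.exists_max π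
  -- Maximum principle: by symmetry, stationarity says that `π τ` is an average of `π` over the
  -- successors of `τ`, so a maximum spreads to all of them.
  have hstep : ∀ τ ρ, π τ = π μ → 0 < P τ ρ → π ρ = π μ := by
    intro τ ρ hτ hρ
    by_contra hne
    have hlt : π ρ < π μ := lt_of_le_of_ne (hμ ρ) hne
    have h1 : π τ = ∑ ρ, P τ ρ * π ρ := by
      conv_lhs => rw [← hst]
      simp only [Matrix.vecMul, dotProduct]
      exact Finset.sum_congr rfl fun x _ => by rw [hsymm x τ, mul_comm]
    have h2 : ∑ ρ, P τ ρ * π ρ < ∑ ρ, P τ ρ * π μ :=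
      Finset.sum_lt_sum (fun x _ => mul_le_mul_of_nonneg_left (hμ x) (hP τ x))
        ⟨ρ, Finset.mem_univ _, mul_lt_mul_of_pos_left hlt hρ⟩
    rw [← Finset.sum_mul, hrow, one_mul, ← h1, hτ] at h2
    exact lt_irrefl _ h2
  have hall : ∀ τ, π τ = π μ := by
    intro τ
    have h := hirr μ τ
    induction h with
    | refl => rfl
    | tail _ h ih => exact hstep _ _ ih h
  have hc : (Fintype.card Ω : ℝ) ≠ 0 := by exact_mod_cast Fintype.card_ne_zero
  rw [hall σ]
  simp only [hall, Finset.sum_const, Finset.card_univ, nsmul_eq_mul] at hsum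
  exact eq_inv_of_mul_eq_one_right hsum

theorem IsPath.reflTransGen {α β : Ω} {p : List Ω} (h : IsPath P α β p) :
    Relation.ReflTransGen (fun σ τ => 0 < P σ τ) α β := by
  obtain ⟨h1, h2, h3⟩ := h
  induction p generalizing α with
  | nil => simp at h1
  | cons a p ih =>
    obtain rfl : a = α := by simpa using h1
    cases p with
    | nil =>
      obtain rfl : a = β := by simpa using h2
      exact Relation.ReflTransGen.refl
    | cons b p =>
      rw [List.isChain_cons_cons] at h3
      exact Relation.ReflTransGen.head h3.1 (ih rfl (by simpa using h2) h3.2)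

end Stationary

/-! ### Flow carried out by a list of steps -/

section Steps

variable {V : Type*}

/-- The vertex recolored at a step. -/
def Step.vertex : Step V → V
  | Step.fix v => v
  | Step.split u => u

variable (G : SimpleGraph V) {k : ℕ}

/-- The colors that a step may use, on the way to `β`. -/
def stepColors (β σ : State G k) : Step V → Finset (Fin k)
  | Step.fix v => {β.1 v}
  | Step.split u => available G σ.1 u

variable {G}

theorem isSucc_iff [DecidableEq V] {β σ τ : State G k} {s : Step V} :
    IsSucc G β σ τ s ↔ ∃ c ∈ stepColors G β σ s, τ.1 = Function.update σ.1 s.vertex c := by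
  cases s <;> simp [IsSucc, stepColors, Step.vertex]

/-- A fixing step has exactly one color, so both kinds of step divide by the number of their colors.
This number does not depend on `β`, which may be chosen freely. -/
theorem splitWeight_cons {β σ : State G k} {s : Step V} {l : List (Step V)}
    {p : List (State G k)} :
    splitWeight G (s :: l) (σ :: p) =
      ((stepColors G β σ s).card : ℝ)⁻¹ * splitWeight G l p := by
  cases s <;> simp [splitWeight, stepColors]

theorem splitWeight_nonneg (l : List (Step V)) (p : List (State G k)) :
    0 ≤ splitWeight G l p := by
  induction l generalizing p with
  | nil => simp [splitWeight]
  | cons s l ih =>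
    cases p with
    | nil => cases s <;> simp [splitWeight]
    | cons σ p =>
      rw [splitWeight_cons (β := σ)]
      exact mul_nonneg (by positivity) (ih p)

/-- The weight reads only the state before each step, so a final move to a singly-flawed endpoint
leaves it unchanged. -/
theorem splitWeight_append {l : List (Step V)} {p q : List (State G k)} (h : l.length ≤ p.length) :
    splitWeight G l (p ++ q) = splitWeight G l p := by
  induction l generalizing p with
  | nil => simp [splitWeight]
  | cons s l ih =>
    cases p with
    | nil => simp at h
    | cons σ p =>
      rw [List.cons_append, splitWeight_cons (β := σ), splitWeight_cons (β := σ),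
        ih (by simpa using h)]

/-- Starting from a state, all recolorings required by a list of steps lead to states,
and they end in a state that satisfies `Q`. -/
def IsSafe [DecidableEq V] (β : State G k) : List (Step V) → (State G k → Prop) → State G k → Prop
  | [], Q, σ => Q σ
  | s :: l, Q, σ =>
      (∀ c ∈ stepColors G β σ s, ∃ τ : State G k, τ.1 = Function.update σ.1 s.vertex c) ∧
        ∀ τ, IsSucc G β σ τ s → IsSafe β l Q τ

theorem IsSafe.mono [DecidableEq V] {β σ : State G k} {l : List (Step V)} {Q Q' : State G k → Prop}
    (h : IsSafe β l Q σ) (hQ : ∀ τ, Q τ → Q' τ) : IsSafe β l Q' σ := by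
  induction l generalizing σ with
  | nil => exact hQ _ h
  | cons s l ih => exact ⟨h.1, fun τ hτ => ih (h.2 τ hτ)⟩

theorem IsSafe.append [DecidableEq V] {β σ : State G k} {l l' : List (Step V)}
    {Q : State G k → Prop}
    (h : IsSafe β l (IsSafe β l' Q) σ) : IsSafe β (l ++ l') Q σ := by
  induction l generalizing σ with
  | nil => exact h
  | cons s l ih => exact ⟨h.1, fun τ hτ => ih (h.2 τ hτ)⟩

variable [Fintype V]

open Classical in
/-- The vertices whose last recoloring is a splitting step. -/
def openVertices (l : List (Step V)) : Finset V :=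
  Finset.univ.filter fun u => Step.split u ∈ l ∧ Step.fix u ∉ l

theorem mem_openVertices {l : List (Step V)} {u : V} :
    u ∈ openVertices l ↔ Step.split u ∈ l ∧ Step.fix u ∉ l := by
  simp [openVertices]

theorem one_le_card_stepColors [DecidableRel G.Adj] (hk : G.maxDegree < k) (β σ : State G k)
    (s : Step V) : 1 ≤ (stepColors G β σ s).card := by
  cases s with
  | fix v => simp [stepColors]
  | split u =>
    have := le_card_available (G := G) σ.1 u
    simp only [stepColors]
    omega

variable (G) in
open Classical in
/-- The states that may follow `σ` at a step. -/
def successors [DecidableEq V] (β σ : State G k) (s : Step V) : Finset (State G k) :=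
  Finset.univ.filter fun τ => IsSucc G β σ τ s

variable [DecidableEq V]

theorem mem_successors {β σ τ : State G k} {s : Step V} :
    τ ∈ successors G β σ s ↔ IsSucc G β σ τ s := by
  simp [successors]

theorem card_successors_le (β σ : State G k) (s : Step V) :
    (successors G β σ s).card ≤ (stepColors G β σ s).card := by
  refine Finset.card_le_card_of_injOn (fun τ => τ.1 s.vertex) ?_ ?_
  · intro τ hτ
    obtain ⟨c, hc, h⟩ := isSucc_iff.1 (mem_successors.1 hτ)
    simpa [h] using hc
  · intro τ hτ τ' hτ' he
    obtain ⟨c, hc, h⟩ := isSucc_iff.1 (mem_successors.1 hτ)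
    obtain ⟨c', hc', h'⟩ := isSucc_iff.1 (mem_successors.1 hτ')
    simp only [h, h', Function.update_self] at he
    exact Subtype.ext (by rw [h, h', he])

theorem card_successors_eq {β σ : State G k} {s : Step V}
    (hs : ∀ c ∈ stepColors G β σ s, ∃ τ : State G k, τ.1 = Function.update σ.1 s.vertex c) :
    (successors G β σ s).card = (stepColors G β σ s).card := by
  refine le_antisymm (card_successors_le β σ s) ?_
  refine Finset.card_le_card_of_surjOn (fun τ => τ.1 s.vertex) ?_
  intro c hc
  obtain ⟨τ, hτ⟩ := hs c hc
  exact ⟨τ, mem_successors.2 (isSucc_iff.2 ⟨c, hc, hτ⟩), by simp [hτ]⟩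

theorem stepPaths_head {β σ : State G k} {l : List (Step V)} {p : List (State G k)}
    (hp : p ∈ stepPaths G β l σ) : ∃ p', p = σ :: p' := by
  cases l with
  | nil => exact ⟨[], by simpa [stepPaths] using hp⟩
  | cons s l =>
    simp only [stepPaths, Finset.mem_biUnion, Finset.mem_image] at hp
    obtain ⟨τ, -, p', -, rfl⟩ := hp
    exact ⟨p', rfl⟩

/-- The union over successors is disjoint because the second state of a path reveals the successor.
-/
theorem sum_stepPaths_cons (β σ : State G k) (s : Step V) (l : List (Step V))
    (F : List (State G k) → ℝ) :
    ∑ p ∈ stepPaths G β (s :: l) σ, F p =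
      ∑ τ ∈ successors G β σ s, ∑ p ∈ stepPaths G β l τ, F (σ :: p) := by
  rw [stepPaths, Finset.sum_biUnion]
  · refine Finset.sum_congr rfl fun τ _ => ?_
    exact Finset.sum_image fun p _ q _ h => List.cons_injective h
  · intro τ _ τ' _ hne
    rw [Function.onFun, Finset.disjoint_left]
    intro p hp hp'
    obtain ⟨q, hq, rfl⟩ := Finset.mem_image.1 hp
    obtain ⟨q', hq', he⟩ := Finset.mem_image.1 hp'
    obtain rfl := List.cons_injective he
    obtain ⟨r, rfl⟩ := stepPaths_head hq
    obtain ⟨r', h⟩ := stepPaths_head hq'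
    exact hne (List.cons.inj h).1

theorem length_of_mem_stepPaths {β σ : State G k} {l : List (Step V)} {p : List (State G k)}
    (hp : p ∈ stepPaths G β l σ) : p.length = l.length + 1 := by
  induction l generalizing σ p with
  | nil => simp [Finset.mem_singleton.1 hp]
  | cons s l ih =>
    simp only [stepPaths, Finset.mem_biUnion, Finset.mem_image] at hp
    obtain ⟨τ, -, p', hp', rfl⟩ := hp
    simp [ih hp']

theorem isChain_of_mem_stepPaths {β σ : State G k} {l : List (Step V)} {p : List (State G k)}
    (hp : p ∈ stepPaths G β l σ) : p.IsChain (fun σ τ => 0 < transition G k σ τ) := by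
  induction l generalizing σ p with
  | nil => simp [Finset.mem_singleton.1 hp]
  | cons s l ih =>
    simp only [stepPaths, Finset.mem_biUnion, Finset.mem_image, Finset.mem_filter] at hp
    obtain ⟨τ, ⟨-, hτ⟩, p', hp', rfl⟩ := hp
    have := ih hp'
    obtain ⟨r, rfl⟩ := stepPaths_head hp'
    obtain ⟨c, -, h⟩ := isSucc_iff.1 hτ
    exact List.IsChain.cons_cons (transition_pos_of_eq_update h) this

theorem IsSafe.exists_getLast {β σ : State G k} {l : List (Step V)} {Q : State G k → Prop}
    (h : IsSafe β l Q σ) {p : List (State G k)} (hp : p ∈ stepPaths G β l σ) :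
    ∃ τ, p.getLast? = some τ ∧ Q τ := by
  induction l generalizing σ p with
  | nil => exact ⟨σ, by simp [Finset.mem_singleton.1 hp], h⟩
  | cons s l ih =>
    simp only [stepPaths, Finset.mem_biUnion, Finset.mem_image, Finset.mem_filter] at hp
    obtain ⟨τ, ⟨-, hτ⟩, p', hp', rfl⟩ := hp
    obtain ⟨ρ, hρ, hQ⟩ := ih (h.2 τ hτ) hp'
    obtain ⟨r, rfl⟩ := stepPaths_head hp'
    exact ⟨ρ, by simpa using hρ, hQ⟩

theorem sum_splitWeight_cons (β σ : State G k) (s : Step V) (l : List (Step V)) :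
    ∑ p ∈ stepPaths G β (s :: l) σ, splitWeight G (s :: l) p =
      ((stepColors G β σ s).card : ℝ)⁻¹ *
        ∑ τ ∈ successors G β σ s, ∑ p ∈ stepPaths G β l τ, splitWeight G l p := by
  rw [sum_stepPaths_cons]
  simp only [splitWeight_cons (β := β), Finset.mul_sum]

/-- Successors are at most as many as colors, so this is at most an average; if there are no colors
the factor is `0⁻¹ = 0`. -/
theorem inv_card_mul_sum_successors_le {β σ : State G k} {s : Step V} {f : State G k → ℝ}
    {C : ℝ} (hC : 0 ≤ C) (h : ∀ τ ∈ successors G β σ s, f τ ≤ C) :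
    ((stepColors G β σ s).card : ℝ)⁻¹ * ∑ τ ∈ successors G β σ s, f τ ≤ C := by
  have h1 : ∑ τ ∈ successors G β σ s, f τ ≤ (stepColors G β σ s).card * C := by
    calc _ ≤ (successors G β σ s).card • C := Finset.sum_le_card_nsmul _ _ _ h
      _ ≤ _ := by
        rw [nsmul_eq_mul]
        gcongr
        exact card_successors_le β σ s
  rcases Nat.eq_zero_or_pos (stepColors G β σ s).card with h0 | h0
  · simpa [h0] using hC
  · rw [inv_mul_le_iff₀ (by exact_mod_cast h0)]
    exact h1

theorem sum_splitWeight_le_one (β σ : State G k) (l : List (Step V)) :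
    ∑ p ∈ stepPaths G β l σ, splitWeight G l p ≤ 1 := by
  induction l generalizing σ with
  | nil => simp [stepPaths, splitWeight]
  | cons s l ih =>
    rw [sum_splitWeight_cons]
    exact inv_card_mul_sum_successors_le zero_le_one fun τ _ => ih τ

/-- On a safe list every color leads to a state, so the equal shares add up to everything that
enters. -/
theorem IsSafe.sum_splitWeight [DecidableRel G.Adj] (hk : G.maxDegree < k) {β σ : State G k}
    {l : List (Step V)} {Q : State G k → Prop} (h : IsSafe β l Q σ) :
    ∑ p ∈ stepPaths G β l σ, splitWeight G l p = 1 := by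
  induction l generalizing σ with
  | nil => simp [stepPaths, splitWeight]
  | cons s l ih =>
    rw [sum_splitWeight_cons, Finset.sum_congr rfl fun τ hτ => ih (h.2 τ (mem_successors.1 hτ)),
      Finset.sum_const, card_successors_eq h.1, nsmul_eq_mul, mul_one]
    have := one_le_card_stepColors hk β σ s
    exact inv_mul_cancel₀ (by exact_mod_cast (by omega))

/-- The fraction of the flow from `σ` that is at `τ` after a list of steps. -/
def reach (β : State G k) : List (Step V) → State G k → State G k → ℝ
  | [], σ, τ => if σ = τ then 1 else 0
  | s :: l, σ, τ =>
      ((stepColors G β σ s).card : ℝ)⁻¹ * ∑ ρ ∈ successors G β σ s, reach β l ρ τ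

theorem reach_nonneg (β : State G k) (l : List (Step V)) (σ τ : State G k) :
    0 ≤ reach β l σ τ := by
  induction l generalizing σ with
  | nil => unfold reach; positivity
  | cons s l ih => exact mul_nonneg (by positivity) (Finset.sum_nonneg fun ρ _ => ih ρ)

theorem exists_of_reach_cons_ne_zero {β σ τ : State G k} {s : Step V} {l : List (Step V)}
    (h : reach β (s :: l) σ τ ≠ 0) : ∃ ρ, IsSucc G β σ ρ s ∧ reach β l ρ τ ≠ 0 := by
  obtain ⟨ρ, hρ, h⟩ := Finset.exists_ne_zero_of_sum_ne_zero (right_ne_zero_of_mul h)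
  exact ⟨ρ, mem_successors.1 hρ, h⟩

theorem eq_of_reach_ne_zero {β σ τ : State G k} {l : List (Step V)} (h : reach β l σ τ ≠ 0)
    {w : V} (hw : w ∉ l.map Step.vertex) : τ.1 w = σ.1 w := by
  induction l generalizing σ with
  | nil =>
    by_cases hne : σ = τ
    · rw [hne]
    · simp [reach, hne] at h
  | cons s l ih =>
    obtain ⟨ρ, hρ, h⟩ := exists_of_reach_cons_ne_zero h
    obtain ⟨c, -, hc⟩ := isSucc_iff.1 hρ
    simp only [List.map_cons, List.mem_cons, not_or] at hw
    rw [ih h hw.2, hc, Function.update_of_ne hw.1]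

/-- No vertex is split after it has been fixed. -/
def FixedLast (l : List (Step V)) : Prop :=
  l.Pairwise fun s t => ∀ v, s = Step.fix v → t ≠ Step.split v

/-- After its last fixing step a vertex is not touched again, since no split of it may follow. -/
theorem eq_of_reach_ne_zero_of_fix_mem {β σ τ : State G k} {l : List (Step V)}
    (hl : FixedLast l) (h : reach β l σ τ ≠ 0) {v : V} (hv : Step.fix v ∈ l) :
    τ.1 v = β.1 v := by
  induction l generalizing σ with
  | nil => simp at hv
  | cons s l ih =>
    obtain ⟨ρ, hρ, hρτ⟩ := exists_of_reach_cons_ne_zero h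
    rw [FixedLast, List.pairwise_cons] at hl
    by_cases hvl : Step.fix v ∈ l
    · exact ih hl.2 hρτ hvl
    · obtain rfl : s = Step.fix v := by
        rcases List.mem_cons.1 hv with hv | hv
        · exact hv.symm
        · exact absurd hv hvl
      have hρ' : ρ.1 = Function.update σ.1 v (β.1 v) := hρ
      rw [eq_of_reach_ne_zero hρτ, hρ', Function.update_self]
      intro hmem
      obtain ⟨t, ht, htv⟩ := List.mem_map.1 hmem
      cases t with
      | fix w => exact hvl (by rwa [← (show w = v from htv)])
      | split w => exact hl.1 _ ht v rfl (by rw [← (show w = v from htv)])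

/-- Each open vertex gains a factor at its last split: its color is final from then on, so only one
of at least `k - Δ` branches can still arrive at `τ`. All other steps merely average. -/
theorem reach_le [DecidableRel G.Adj] (hk : G.maxDegree < k) (β σ τ : State G k)
    (l : List (Step V)) :
    reach β l σ τ ≤ (((k - G.maxDegree : ℕ) : ℝ)⁻¹) ^ (openVertices l).card := by
  set d := k - G.maxDegree
  have hd : 1 ≤ d := by omega
  have hd1 : ((d : ℝ)⁻¹) ≤ 1 := inv_le_one_of_one_le₀ (by exact_mod_cast hd)
  have hd0 : (0 : ℝ) ≤ (d : ℝ)⁻¹ := by positivity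
  induction l generalizing σ with
  | nil =>
    have : openVertices ([] : List (Step V)) = ∅ := by ext; simp [mem_openVertices]
    rw [this, Finset.card_empty, pow_zero, reach]
    split_ifs <;> norm_num
  | cons s l ih =>
    have havg : reach β (s :: l) σ τ ≤ ((d : ℝ)⁻¹) ^ (openVertices l).card :=
      inv_card_mul_sum_successors_le (by positivity) fun ρ _ => ih ρ
    by_cases hsub : openVertices (s :: l) ⊆ openVertices l
    · exact havg.trans (pow_le_pow_of_le_one hd0 hd1 (Finset.card_le_card hsub))
    · obtain ⟨u, hu, hul⟩ := Finset.not_subset.1 hsub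
      rw [mem_openVertices] at hu hul
      have hfix : Step.fix u ∉ l := fun h => hu.2 (List.mem_cons_of_mem _ h)
      have hsplit : Step.split u ∉ l := fun h => hul ⟨h, hfix⟩
      obtain rfl : s = Step.split u := by
        rcases List.mem_cons.1 hu.1 with h | h
        · exact h.symm
        · exact absurd h hsplit
      have hul' : u ∉ l.map Step.vertex := by
        intro hmem
        obtain ⟨t, ht, htv⟩ := List.mem_map.1 hmem
        cases t with
        | fix w => exact hfix (by rwa [← (show w = u from htv)])
        | split w => exact hsplit (by rwa [← (show w = u from htv)])
      have hcard : (openVertices (Step.split u :: l)).card ≤ (openVertices l).card + 1 := by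
        calc _ ≤ (insert u (openVertices l)).card := by
              refine Finset.card_le_card fun w hw => ?_
              rw [mem_openVertices] at hw
              rw [Finset.mem_insert, mem_openVertices]
              rcases List.mem_cons.1 hw.1 with h | h
              · exact Or.inl (by injection h)
              · exact Or.inr ⟨h, fun h' => hw.2 (List.mem_cons_of_mem _ h')⟩
          _ ≤ _ := Finset.card_insert_le _ _
      have hsum : ∑ ρ ∈ successors G β σ (Step.split u), reach β l ρ τ ≤
          ((d : ℝ)⁻¹) ^ (openVertices l).card := by
        -- Here `u` is never recolored again, so any contributing successor gives `u` the color it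
        -- has in `τ`; there is at most one.
        rw [← Finset.sum_filter_ne_zero]
        have h1 : ((successors G β σ (Step.split u)).filter fun ρ => reach β l ρ τ ≠ 0).card
            ≤ 1 := by
          refine Finset.card_le_one.2 fun ρ hρ ρ' hρ' => ?_
          rw [Finset.mem_filter, mem_successors] at hρ hρ'
          obtain ⟨c, -, hc⟩ := hρ.1
          obtain ⟨c', -, hc'⟩ := hρ'.1
          have e := eq_of_reach_ne_zero hρ.2 hul'
          have e' := eq_of_reach_ne_zero hρ'.2 hul'
          rw [hc, Function.update_self] at e
          rw [hc', Function.update_self] at e'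
          exact Subtype.ext (by rw [hc, hc', ← e, ← e'])
        calc _ ≤ _ := Finset.sum_le_card_nsmul _ _ _ fun ρ _ => ih ρ
          _ ≤ (1 : ℕ) • ((d : ℝ)⁻¹) ^ (openVertices l).card :=
            nsmul_le_nsmul_left (by positivity) h1
          _ = _ := one_nsmul _
      calc reach β (Step.split u :: l) σ τ
          ≤ (d : ℝ)⁻¹ * ((d : ℝ)⁻¹) ^ (openVertices l).card := by
            refine mul_le_mul ?_ hsum (Finset.sum_nonneg fun ρ _ => reach_nonneg _ _ _ _) hd0
            have : d ≤ (available G σ.1 u).card := le_card_available σ.1 u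
            exact inv_anti₀ (by exact_mod_cast hd) (by exact_mod_cast this)
        _ = ((d : ℝ)⁻¹) ^ ((openVertices l).card + 1) := (pow_succ' _ _).symm
        _ ≤ _ := pow_le_pow_of_le_one hd0 hd1 hcard

/-- The transition `t` recolors at most the vertex of the step `s`. -/
def Step.Compatible (s : Step V) (t : State G k × State G k) : Prop :=
  ∀ w, w ≠ s.vertex → t.1.1 w = t.2.1 w

open Classical in
theorem sum_splitWeight_filter_le (hcol : ∀ β σ : State G k, ∀ s, 1 ≤ (stepColors G β σ s).card)
    (β σ : State G k) (l : List (Step V))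
    (t : State G k × State G k) :
    ∑ p ∈ (stepPaths G β l σ).filter (fun p => t ∈ pathEdges p), splitWeight G l p ≤
      ∑ i : Fin l.length,
        if (l.get i).Compatible t then reach β (l.take i) σ t.1 else 0 := by
  induction l generalizing σ with
  | nil =>
    rw [Finset.sum_eq_zero]
    · exact Finset.sum_nonneg fun i _ => i.elim0
    · intro p hp
      rw [Finset.mem_filter, stepPaths, Finset.mem_singleton] at hp
      obtain ⟨rfl, hp⟩ := hp
      simp [pathEdges] at hp
  | cons s l ih =>
    have hq0 : (0 : ℝ) ≤ ((stepColors G β σ s).card : ℝ)⁻¹ := by positivity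
    have hq1 : ((stepColors G β σ s).card : ℝ)⁻¹ ≤ 1 :=
      inv_le_one_of_one_le₀ (by exact_mod_cast hcol β σ s)
    have h1 : ∀ τ ∈ successors G β σ s, ∑ p ∈ stepPaths G β l τ,
        (if t ∈ pathEdges (σ :: p) then splitWeight G l p else 0) ≤
        (if t = (σ, τ) then 1 else 0) + ∑ i : Fin l.length,
          if (l.get i).Compatible t then reach β (l.take i) τ t.1 else 0 := by
      intro τ _
      have h2 : ∀ p ∈ stepPaths G β l τ,
          (if t ∈ pathEdges (σ :: p) then splitWeight G l p else 0) ≤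
          (if t = (σ, τ) then 1 else 0) * splitWeight G l p +
            (if t ∈ pathEdges p then splitWeight G l p else 0) := by
        intro p hp
        have hw := splitWeight_nonneg l p
        obtain ⟨r, rfl⟩ := stepPaths_head hp
        have : t ∈ pathEdges (σ :: τ :: r) ↔ t = (σ, τ) ∨ t ∈ pathEdges (τ :: r) := by
          simp [pathEdges]
        simp only [this]
        by_cases ha : t = (σ, τ) <;> by_cases hb : t ∈ pathEdges (τ :: r) <;>
          simp only [ha, hb, if_true, if_false, true_or, or_true, or_self] <;>
          (try split_ifs) <;> linarith
      calc _ ≤ _ := Finset.sum_le_sum h2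
        _ = (if t = (σ, τ) then 1 else 0) * ∑ p ∈ stepPaths G β l τ, splitWeight G l p +
            ∑ p ∈ (stepPaths G β l τ).filter (fun p => t ∈ pathEdges p), splitWeight G l p := by
            rw [Finset.sum_add_distrib, Finset.mul_sum, Finset.sum_filter]
        _ ≤ _ := by
            refine add_le_add ?_ (ih τ)
            exact mul_le_of_le_one_right (by positivity) (sum_splitWeight_le_one β τ l)
    have h3 : ∑ τ ∈ successors G β σ s, (if t = (σ, τ) then (1 : ℝ) else 0) ≤
        if s.Compatible t then (if σ = t.1 then 1 else 0) else 0 := by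
      by_cases hc : t.1 = σ ∧ IsSucc G β σ t.2 s
      · have hcomp : s.Compatible t := by
          intro w hw
          obtain ⟨c, -, h⟩ := isSucc_iff.1 hc.2
          rw [h, Function.update_of_ne hw, hc.1]
        rw [if_pos hcomp, if_pos hc.1.symm]
        calc _ ≤ ∑ τ ∈ successors G β σ s, (if t.2 = τ then (1 : ℝ) else 0) := by
              refine Finset.sum_le_sum fun τ _ => ?_
              by_cases h : t = (σ, τ)
              · rw [if_pos h, if_pos (by rw [h])]
              · rw [if_neg h]
                positivity
          _ ≤ 1 := by
              rw [Finset.sum_ite_eq]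
              split_ifs <;> norm_num
      · rw [Finset.sum_eq_zero]
        · positivity
        · intro τ hτ
          refine if_neg fun h => hc ?_
          rw [h]
          exact ⟨rfl, mem_successors.1 hτ⟩
    calc ∑ p ∈ (stepPaths G β (s :: l) σ).filter (fun p => t ∈ pathEdges p),
          splitWeight G (s :: l) p
        = ((stepColors G β σ s).card : ℝ)⁻¹ * ∑ τ ∈ successors G β σ s, ∑ p ∈ stepPaths G β l τ,
            (if t ∈ pathEdges (σ :: p) then splitWeight G l p else 0) := by
          rw [Finset.sum_filter, sum_stepPaths_cons]
          simp only [splitWeight_cons (β := β), Finset.mul_sum, mul_ite, mul_zero]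
      _ ≤ ((stepColors G β σ s).card : ℝ)⁻¹ * ∑ τ ∈ successors G β σ s,
            ((if t = (σ, τ) then 1 else 0) + ∑ i : Fin l.length,
              if (l.get i).Compatible t then reach β (l.take i) τ t.1 else 0) :=
          mul_le_mul_of_nonneg_left (Finset.sum_le_sum h1) hq0
      _ = ((stepColors G β σ s).card : ℝ)⁻¹ *
            ∑ τ ∈ successors G β σ s, (if t = (σ, τ) then (1 : ℝ) else 0) +
          ∑ i : Fin l.length, if (l.get i).Compatible t then
            ((stepColors G β σ s).card : ℝ)⁻¹ *
              ∑ τ ∈ successors G β σ s, reach β (l.take i) τ t.1 else 0 := by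
          rw [Finset.sum_add_distrib, mul_add, Finset.sum_comm (t := Finset.univ)]
          congr 1
          rw [Finset.mul_sum]
          refine Finset.sum_congr rfl fun i _ => ?_
          split_ifs <;> simp
      _ ≤ (if s.Compatible t then (if σ = t.1 then 1 else 0) else 0) +
          ∑ i : Fin l.length, if (l.get i).Compatible t then
            ((stepColors G β σ s).card : ℝ)⁻¹ *
              ∑ τ ∈ successors G β σ s, reach β (l.take i) τ t.1 else 0 := by
          refine add_le_add ?_ le_rfl
          refine (mul_le_of_le_one_left ?_ hq1).trans h3
          exact Finset.sum_nonneg fun τ _ => by positivity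
      _ = _ := by
          exact (Fin.sum_univ_succ (n := l.length) fun i => if ((s :: l).get i).Compatible t then
            reach β ((s :: l).take i) σ t.1 else 0).symm

end Steps

/-! ### The schedule: safety, separators and the encoding bound -/

section Schedule

/-- All flaws join `v` to vertices still to be split. Each split clears one such vertex and creates
no flaw, so `v` stays on every monochromatic edge until none is left. -/
theorem isSafe_splits {V : Type*} [DecidableEq V] {G : SimpleGraph V} {k : ℕ}
    {β σ : State G k} {v : V} {D : Set V} {R : List V}
    (hR : ∀ u ∈ R, u ∉ D) (hvR : v ∉ R)
    (hmono : ∀ a b, G.Adj a b → σ.1 a = σ.1 b → (a = v ∧ b ∈ R) ∨ (b = v ∧ a ∈ R))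
    (hD : ∀ w ∈ D, σ.1 w = β.1 w) :
    IsSafe β (R.map Step.split) (fun τ => IsProper G τ.1 ∧ ∀ w ∈ D, τ.1 w = β.1 w) σ := by
  induction R generalizing σ with
  | nil => exact ⟨isProper_iff.2 fun a b hab he => by simpa using hmono a b hab he, hD⟩
  | cons u R ih =>
    have key : ∀ c ∈ available G σ.1 u, ∀ a b, G.Adj a b →
        Function.update σ.1 u c a = Function.update σ.1 u c b →
          (a = v ∧ b ∈ R) ∨ (b = v ∧ a ∈ R) := by
      intro c hc a b hab he
      obtain ⟨ha, hb, he⟩ := mono_update_of_mem_available hc hab he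
      have := hmono a b hab he
      simpa [ha, hb] using this
    refine ⟨fun c hc => ⟨⟨Function.update σ.1 u c, ?_⟩, rfl⟩, fun τ hτ => ?_⟩
    · exact isProper_or_isSinglyFlawed v fun a b hab he =>
        (key c hc a b hab he).imp And.left And.left
    · obtain ⟨c, hc, hτ⟩ := hτ
      refine ih (fun w hw => hR w (List.mem_cons_of_mem _ hw))
        (fun h => hvR (List.mem_cons_of_mem _ h)) ?_ ?_
      · rw [hτ]
        exact key c hc
      · intro w hw
        have hwu : w ≠ u := by
          rintro rfl
          exact hR w List.mem_cons_self hw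
        rw [hτ, Function.update_of_ne hwu, hD w hw]

variable {V : Type*} [Fintype V] (G : SimpleGraph V) {k : ℕ}

open Classical in
/-- The vertices of the minimal separator for `j`, in order. -/
def separatorList (L : LinOrd V) (j : Fin (Fintype.card V)) : List V :=
  ((List.finRange (Fintype.card V)).map L.symm).filter fun u => u ∈ mvs G L j

theorem mem_separatorList {L : LinOrd V} {j : Fin (Fintype.card V)} {u : V} :
    u ∈ separatorList G L j ↔ u ∈ mvs G L j := by
  simp only [separatorList, List.mem_filter, List.mem_map, List.mem_finRange, true_and,
    decide_eq_true_eq, and_iff_right_iff_imp]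
  exact fun _ => ⟨L u, L.symm_apply_apply u⟩

theorem nodup_separatorList (L : LinOrd V) (j : Fin (Fintype.card V)) :
    (separatorList G L j).Nodup :=
  ((List.nodup_finRange _).map L.symm.injective).filter _

theorem length_separatorList_le (L : LinOrd V) (j : Fin (Fintype.card V)) :
    (separatorList G L j).length ≤ vsnOrder G L := by
  classical
  rw [← List.toFinset_card_of_nodup (nodup_separatorList G L j)]
  refine le_trans (Finset.card_le_card fun u hu => ?_) (card_mvs_le G L j)
  exact (mem_separatorList G).1 (List.mem_toFinset.1 hu)

variable (k) in
open Classical in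
/-- The proper colorings, as states. -/
def properStates : Finset (State G k) := Finset.univ.filter fun σ => IsProper G σ.1

variable {G} in
theorem mem_properStates {σ : State G k} : σ ∈ properStates G k ↔ IsProper G σ.1 := by
  simp [properStates]

variable [DecidableEq V]

theorem phase_eq (L : LinOrd V) (j : Fin (Fintype.card V)) :
    phase G L j = Step.fix (L.symm j) :: (separatorList G L j).map Step.split := by
  unfold phase separatorList
  congr!

theorem length_schedule_le (L : LinOrd V) :
    (schedule G L).length ≤ Fintype.card V * (1 + vsnOrder G L) := by
  rw [schedule, List.length_flatMap]
  have h := List.sum_le_card_nsmul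
    ((List.finRange (Fintype.card V)).map fun j => (phase G L j).length) (1 + vsnOrder G L) (by
      intro x hx
      obtain ⟨j, -, rfl⟩ := List.mem_map.1 hx
      rw [phase_eq, List.length_cons, List.length_map, add_comm]
      exact Nat.add_le_add_left (length_separatorList_le G L j) 1)
  simpa using h

/-- A phase recolors a vertex at most once: its separator has no repetitions and lies strictly after
the fixed vertex. -/
theorem count_vertex_schedule_le (L : LinOrd V) (v : V) :
    ((schedule G L).map Step.vertex).count v ≤ Fintype.card V := by
  rw [schedule, List.map_flatMap, List.count_flatMap]
  have h := List.sum_le_card_nsmul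
    ((List.finRange (Fintype.card V)).map
      (List.count v ∘ fun j => (phase G L j).map Step.vertex)) 1 (by
      intro x hx
      obtain ⟨j, -, rfl⟩ := List.mem_map.1 hx
      refine List.nodup_iff_count_le_one.1 ?_ v
      have : (Step.vertex ∘ Step.split : V → V) = id := rfl
      change ((phase G L j).map Step.vertex).Nodup
      rw [phase_eq, List.map_cons, List.map_map, this, List.map_id, List.nodup_cons]
      refine ⟨fun hmem => ?_, nodup_separatorList G L j⟩
      have := ((mem_mvs G).1 ((mem_separatorList G).1 hmem)).1
      simp [Step.vertex] at this)
  simpa using h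

/-- The order constraints on two steps of a schedule, the first preceding the second. -/
def StepLT (L : LinOrd V) : Step V → Step V → Prop
  | Step.fix v, Step.fix w => L v < L w
  | Step.fix v, Step.split u => L v < L u
  | Step.split u, Step.fix w => ∃ w', L w' < L w ∧ G.Adj w' u
  | Step.split _, Step.split _ => True

theorem pairwise_schedule (L : LinOrd V) : (schedule G L).Pairwise (StepLT G L) := by
  rw [schedule, List.pairwise_flatMap]
  constructor
  · intro j _
    rw [phase_eq, List.pairwise_cons, List.pairwise_map]
    constructor
    · intro s hs
      obtain ⟨u, hu, rfl⟩ := List.mem_map.1 hs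
      have := ((mem_mvs G).1 ((mem_separatorList G).1 hu)).1
      simpa [StepLT] using this
    · exact List.pairwise_of_forall fun _ _ => trivial
  · refine (List.pairwise_lt_finRange _).imp fun {i j} hij s hs t ht => ?_
    rw [phase_eq, List.mem_cons, List.mem_map] at hs ht
    rcases hs with rfl | ⟨u, hu, rfl⟩ <;> rcases ht with rfl | ⟨w, hw, rfl⟩
    · simpa [StepLT] using hij
    · have := ((mem_mvs G).1 ((mem_separatorList G).1 hw)).1
      simpa [StepLT] using hij.trans this
    · obtain ⟨-, w', hw', hadj⟩ := (mem_mvs G).1 ((mem_separatorList G).1 hu)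
      exact ⟨w', by simpa using lt_of_le_of_lt hw' hij, hadj⟩
    · trivial

theorem fix_mem_schedule (L : LinOrd V) (v : V) : Step.fix v ∈ schedule G L := by
  rw [schedule, List.mem_flatMap]
  exact ⟨L v, List.mem_finRange _, by rw [phase_eq]; simp⟩

theorem exists_adj_of_split_mem_schedule {L : LinOrd V} {u : V}
    (h : Step.split u ∈ schedule G L) : ∃ w, G.Adj w u := by
  rw [schedule, List.mem_flatMap] at h
  obtain ⟨j, -, h⟩ := h
  rw [phase_eq] at h
  simp only [List.mem_cons, reduceCtorEq, List.mem_map, Step.split.injEq, exists_eq_right,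
    false_or] at h
  obtain ⟨-, w, -, hadj⟩ := (mem_mvs G).1 ((mem_separatorList G).1 h)
  exact ⟨w, hadj⟩

variable {G}

/-- Every vertex is fixed somewhere in the schedule, so the fixing step of `w` is still to come and
follows `s`. -/
theorem stepLT_of_mem_take {L : LinOrd V} {i : ℕ} {s : Step V} {w : V}
    (hs : s ∈ (schedule G L).take i) (hw : Step.fix w ∉ (schedule G L).take i) :
    StepLT G L s (Step.fix w) := by
  have h := pairwise_schedule G L
  rw [← List.take_append_drop i (schedule G L), List.pairwise_append] at h
  refine h.2.2 s hs _ ?_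
  have hmem := fix_mem_schedule G L w
  rw [← List.take_append_drop i (schedule G L), List.mem_append] at hmem
  exact hmem.resolve_left hw

/-- The first neighbor of `u` in the order works: were it not yet fixed, the order constraints would
give `u` a still earlier neighbor. -/
theorem exists_fix_mem_take {L : LinOrd V} {i : ℕ} {u : V}
    (hu : Step.split u ∈ (schedule G L).take i) :
    ∃ w, Step.fix w ∈ (schedule G L).take i ∧ G.Adj w u := by
  classical
  obtain ⟨w₀, hw₀⟩ := exists_adj_of_split_mem_schedule G (List.mem_of_mem_take hu)
  obtain ⟨w, hw, hmin⟩ := Finset.exists_min_image (Finset.univ.filter fun w => G.Adj w u) L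
    ⟨w₀, by simpa using hw₀⟩
  simp only [Finset.mem_filter, Finset.mem_univ, true_and] at hw hmin
  refine ⟨w, by_contra fun hnot => ?_, hw⟩
  obtain ⟨w', hlt, hadj⟩ := stepLT_of_mem_take hu hnot
  exact absurd (hmin w' hadj) (not_le.2 hlt)

theorem fixedLast_take (L : LinOrd V) (i : ℕ) : FixedLast ((schedule G L).take i) := by
  refine ((pairwise_schedule G L).sublist (List.take_sublist _ _)).imp ?_
  rintro s t h v rfl rfl
  exact lt_irrefl _ h

open Classical in
/-- The vertices fixed by an initial part of a schedule are separated from the others by a set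
of at most `vsnOrder G L` vertices, which contains all open ones. -/
theorem exists_separator (L : LinOrd V) (i : ℕ) :
    ∃ S : Finset V, S.card ≤ vsnOrder G L ∧ openVertices ((schedule G L).take i) ⊆ S ∧
      ∀ a b, Step.fix a ∈ (schedule G L).take i → Step.fix b ∉ (schedule G L).take i →
        b ∉ S → ¬ G.Adj a b := by
  set l := (schedule G L).take i
  by_cases hne : ∃ v, Step.fix v ∈ l
  · obtain ⟨v₀, hv₀⟩ := hne
    obtain ⟨v, hv, hmax⟩ := Finset.exists_max_image
      (Finset.univ.filter fun v => Step.fix v ∈ l) L ⟨v₀, by simpa using hv₀⟩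
    simp only [Finset.mem_filter, Finset.mem_univ, true_and] at hv hmax
    have hlt : ∀ w, Step.fix w ∉ l → L v < L w := fun w hw => stepLT_of_mem_take hv hw
    -- The separator at the last fixed vertex `v` works even in the middle of a phase: the fixed
    -- vertices are exactly those up to `v`, and a split vertex has a fixed neighbor.
    refine ⟨mvs G L (L v), card_mvs_le G L _, fun u hu => ?_, fun a b ha hb hbS hab => hbS ?_⟩
    · rw [mem_openVertices] at hu
      obtain ⟨w, hw, hadj⟩ := exists_fix_mem_take hu.1
      exact (mem_mvs G).2 ⟨hlt u hu.2, w, hmax w hw, hadj⟩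
    · exact (mem_mvs G).2 ⟨hlt b hb, a, hmax a ha, hab⟩
  · push Not at hne
    refine ⟨∅, by simp, fun u hu => ?_, fun a _ ha => absurd ha (hne a)⟩
    obtain ⟨w, hw, -⟩ := exists_fix_mem_take (mem_openVertices.1 hu).1
    exact absurd hw (hne w)

open Classical in
-- The current state shows `β` on the fixed vertices and `α` on the untouched ones, so
-- `card_pairs_le` applies with the open vertices as the unknown part `A`.
theorem card_reach_ne_zero_le [DecidableRel G.Adj] (L : LinOrd V) (i : ℕ) (σ : State G k)
    {S : Finset V}
    (hS : ∀ a b, Step.fix a ∈ (schedule G L).take i → Step.fix b ∉ (schedule G L).take i →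
      b ∉ S → ¬ G.Adj a b) :
    ((properStates G k ×ˢ properStates G k).filter fun x =>
        reach x.2 ((schedule G L).take i) x.1 σ ≠ 0).card ≤
      (Finset.univ.filter fun η : V → Fin k => IsProperOff G S η).card *
        k ^ (openVertices ((schedule G L).take i)).card := by
  have hfl := fixedLast_take (G := G) L i
  generalize (schedule G L).take i = l at hS hfl ⊢
  refine le_trans ?_ (card_pairs_le G σ.1 (Finset.univ.filter fun v => Step.fix v ∈ l)
    (openVertices l) S fun a b ha hb => hS a b (by simpa using ha) (by simpa using hb))
  refine Finset.card_le_card_of_injOn (fun x => (x.1.1, x.2.1)) ?_ ?_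
  · rintro ⟨α, β⟩ hx
    have hx := Finset.mem_filter.1 hx
    rw [Finset.mem_product, mem_properStates, mem_properStates] at hx
    refine Finset.mem_filter.2 ⟨Finset.mem_univ _, hx.1.1, hx.1.2, fun v hv => ?_,
      fun v hvD hvA => ?_⟩
    · exact (eq_of_reach_ne_zero_of_fix_mem hfl hx.2 (by simpa using hv)).symm
    · refine (eq_of_reach_ne_zero hx.2 fun hmem => ?_).symm
      have hfix : Step.fix v ∉ l := by simpa using hvD
      obtain ⟨s, hs, rfl⟩ := List.mem_map.1 hmem
      cases s with
      | fix w => exact hfix hs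
      | split w => exact hvA (mem_openVertices.2 ⟨hs, hfix⟩)
  · rintro ⟨α, β⟩ - ⟨α', β'⟩ - h
    simp only [Prod.mk.injEq] at h
    rw [Subtype.ext h.1, Subtype.ext h.2]

/-- The number of contributing pairs times the largest share of each: `k ^ a` from the encoding
meets `d⁻¹ ^ a` from splitting, and the hybrids contribute `(k / d) ^ |S|`. -/
theorem sum_reach_le [DecidableRel G.Adj] (hk : G.maxDegree < k) (L : LinOrd V) (i : ℕ)
    (σ : State G k) :
    ∑ x ∈ properStates G k ×ˢ properStates G k, reach x.2 ((schedule G L).take i) x.1 σ ≤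
      (properStates G k).card *
        ((k : ℝ) / ((k - G.maxDegree : ℕ) : ℝ)) ^ (2 * vsnOrder G L) := by
  classical
  obtain ⟨S, hScard, hAS, hsep⟩ := exists_separator (G := G) L i
  have hX := card_reach_ne_zero_le L i σ hsep
  have hE := card_isProperOff_mul_pow_le G (k := k) S
  have hCp : (Finset.univ.filter fun η : V → Fin k => IsProper G η).card ≤
      (properStates G k).card := by
    refine Finset.card_le_card_of_surjOn Subtype.val fun η hη => ?_
    have hη : IsProper G η := by simpa using hη
    exact ⟨⟨η, Or.inl hη⟩, by simpa [mem_properStates] using hη, rfl⟩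
  have hr := fun β α : State G k => reach_le hk β α σ ((schedule G L).take i)
  have hAcard := Finset.card_le_card hAS
  generalize (schedule G L).take i = l at hX hr hAcard ⊢
  generalize (Finset.univ.filter fun η : V → Fin k => IsProperOff G S η).card = E at hX hE
  generalize (openVertices l).card = a at hX hr hAcard
  have hd1 : 1 ≤ k - G.maxDegree := by omega
  have hkd : k - G.maxDegree ≤ k := Nat.sub_le _ _
  generalize k - G.maxDegree = d at hE hr hd1 hkd ⊢
  have hd0 : (0 : ℝ) < d := by exact_mod_cast hd1
  have hkd : (1 : ℝ) ≤ k / d := by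
    rw [one_le_div hd0]
    exact_mod_cast hkd
  have hER : (E : ℝ) ≤ (properStates G k).card * ((k : ℝ) / d) ^ S.card := by
    rw [div_pow, mul_div_assoc', le_div_iff₀ (by positivity)]
    exact_mod_cast hE.trans (Nat.mul_le_mul_right _ hCp)
  rw [← Finset.sum_filter_ne_zero]
  refine (Finset.sum_le_card_nsmul _ _ _ fun x _ => hr x.2 x.1).trans ?_
  rw [nsmul_eq_mul]
  calc _ ≤ ((E * k ^ a : ℕ) : ℝ) * ((d : ℝ)⁻¹) ^ a := by
        refine mul_le_mul_of_nonneg_right ?_ (by positivity)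
        exact_mod_cast hX
    _ = E * ((k : ℝ) / d) ^ a := by
        push_cast
        rw [mul_assoc, ← mul_pow, div_eq_mul_inv]
    _ ≤ (properStates G k).card * ((k : ℝ) / d) ^ S.card * ((k : ℝ) / d) ^ a :=
        mul_le_mul_of_nonneg_right hER (by positivity)
    _ = (properStates G k).card * ((k : ℝ) / d) ^ (S.card + a) := by
        rw [mul_assoc, pow_add]
    _ ≤ _ := by
        refine mul_le_mul_of_nonneg_left (pow_le_pow_right₀ hkd ?_) (by positivity)
        omega

open Classical in
-- All compatible steps recolor the one vertex where the two states differ, which happens at most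
-- once per phase.
theorem card_compatible_le {t : State G k × State G k} (hne : t.1 ≠ t.2) (L : LinOrd V) :
    (Finset.univ.filter fun i : Fin (schedule G L).length =>
      ((schedule G L).get i).Compatible t).card ≤ Fintype.card V := by
  obtain ⟨v, hv⟩ : ∃ v, t.1.1 v ≠ t.2.1 v := by
    by_contra! h
    exact hne (Subtype.ext (funext h))
  have key : ∀ l : List (Step V),
      (Finset.univ.filter fun i : Fin l.length => (l.get i).Compatible t).card ≤
        (l.map Step.vertex).count v := by
    intro l
    induction l with
    | nil => simp
    | cons s l ih =>
      rw [Finset.card_filter] at ih ⊢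
      have h := Fin.sum_univ_succ (n := l.length)
        fun i => if ((s :: l).get i).Compatible t then 1 else 0
      refine h.le.trans ?_
      rw [List.map_cons, List.count_cons, add_comm]
      refine add_le_add ih ?_
      split_ifs with h1 h2
      · exact le_rfl
      · refine absurd (by_contra fun hsv => hv (h1 v ?_)) h2
        rintro rfl
        exact hsv (beq_self_eq_true _)
      · exact Nat.zero_le _
      · exact le_rfl
  exact (key _).trans (count_vertex_schedule_le G L v)

theorem isSafe_phase {L : LinOrd V} {j : Fin (Fintype.card V)} {β σ : State G k}
    (hβ : IsProper G β.1) (hσ : IsProper G σ.1) (h : ∀ w, L w < j → σ.1 w = β.1 w) :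
    IsSafe β (phase G L j)
      (fun τ => IsProper G τ.1 ∧ ∀ w ∈ {w | L w ≤ j}, τ.1 w = β.1 w) σ := by
  rw [phase_eq]
  set v := L.symm j
  have hv : L v = j := L.apply_symm_apply j
  rw [isProper_iff] at hβ hσ
  have hle : ∀ w, L w ≤ j → Function.update σ.1 v (β.1 v) w = β.1 w := by
    intro w hw
    by_cases hwv : w = v
    · rw [hwv, Function.update_self]
    · rw [Function.update_of_ne hwv, h w]
      exact lt_of_le_of_ne hw fun he => hwv (L.injective (he.trans hv.symm))
  -- A neighbor up to position `j` already has its color in the proper coloring `β`, so it cannot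
  -- conflict with `v`.
  have hsep : ∀ b, G.Adj v b → β.1 v = Function.update σ.1 v (β.1 v) b →
      b ∈ separatorList G L j := by
    intro b hvb he
    rw [mem_separatorList, mem_mvs]
    refine ⟨lt_of_not_ge fun hb => ?_, v, hv.le, hvb⟩
    rw [hle b hb] at he
    exact hβ v b hvb he
  have key : ∀ a b, G.Adj a b →
      Function.update σ.1 v (β.1 v) a = Function.update σ.1 v (β.1 v) b →
        (a = v ∧ b ∈ separatorList G L j) ∨ (b = v ∧ a ∈ separatorList G L j) := by
    intro a b hab he
    by_cases ha : a = v
    · subst ha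
      rw [Function.update_self] at he
      exact Or.inl ⟨rfl, hsep b hab he⟩
    · by_cases hb : b = v
      · subst hb
        rw [Function.update_self] at he
        exact Or.inr ⟨rfl, hsep a hab.symm he.symm⟩
      · rw [Function.update_of_ne ha, Function.update_of_ne hb] at he
        exact absurd he (hσ a b hab)
  refine ⟨fun c hc => ?_, fun τ hτ => ?_⟩
  · obtain rfl : c = β.1 v := by simpa [stepColors] using hc
    exact ⟨⟨Function.update σ.1 v (β.1 v), isProper_or_isSinglyFlawed v fun a b hab he =>
      (key a b hab he).imp And.left And.left⟩, rfl⟩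
  · have hτ' : τ.1 = Function.update σ.1 v (β.1 v) := hτ
    have hlt : ∀ u ∈ separatorList G L j, j < L u := fun u hu =>
      ((mem_mvs G).1 ((mem_separatorList G).1 hu)).1
    refine isSafe_splits (v := v) ?_ ?_ ?_ ?_
    · exact fun u hu => not_le.2 (hlt u hu)
    · exact fun hmem => absurd (hlt v hmem) (by rw [hv]; exact lt_irrefl _)
    · rw [hτ']
      exact key
    · rw [hτ']
      exact hle

theorem isSafe_schedule (L : LinOrd V) {α β : State G k}
    (hα : IsProper G α.1) (hβ : IsProper G β.1) :
    IsSafe β (schedule G L) (fun τ => τ = β) α := by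
  have key : ∀ m ≤ Fintype.card V,
      IsSafe β (((List.finRange (Fintype.card V)).take m).flatMap (phase G L))
        (fun τ => IsProper G τ.1 ∧ ∀ w, (L w : ℕ) < m → τ.1 w = β.1 w) α := by
    intro m
    induction m with
    | zero => exact fun _ => ⟨hα, fun w hw => absurd hw (Nat.not_lt_zero _)⟩
    | succ m ih =>
      intro hm
      have hm' : m < (List.finRange (Fintype.card V)).length := by simpa using hm
      rw [← List.take_concat_get' _ m hm', List.flatMap_append]
      refine ((ih (by omega)).mono fun σ hσ => ?_).append
      rw [List.flatMap_singleton, List.getElem_finRange]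
      refine (isSafe_phase hβ hσ.1 fun w hw => hσ.2 w (by simpa [Fin.lt_def] using hw)).mono
        fun τ hτ => ⟨hτ.1, fun w hw => hτ.2 w ?_⟩
      simp only [Set.mem_ofPred_eq, Fin.le_def]
      simpa using Nat.lt_succ_iff.1 hw
  have h := key _ le_rfl
  rw [List.take_of_length_le (by simp)] at h
  exact h.mono fun τ hτ => Subtype.ext (funext fun w => hτ.2 w (L w).2)

end Schedule

/-! ### Extending paths at either end -/

section Paths

variable {Ω : Type*} {P : Matrix Ω Ω ℝ}

theorem IsPath.cons {α a β : Ω} {p : List Ω} (h : IsPath P a β p) (hα : 0 < P α a) :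
    IsPath P α β (α :: p) := by
  obtain ⟨h1, h2, h3⟩ := h
  cases p with
  | nil => simp at h1
  | cons b p =>
    obtain rfl : b = a := by simpa using h1
    exact ⟨rfl, by simpa using h2, List.IsChain.cons_cons hα h3⟩

theorem IsPath.concat {α b β : Ω} {p : List Ω} (h : IsPath P α b p) (hβ : 0 < P b β) :
    IsPath P α β (p ++ [β]) := by
  obtain ⟨h1, h2, h3⟩ := h
  refine ⟨by simp [List.head?_append, h1], by simp, ?_⟩
  rw [List.isChain_append]
  refine ⟨h3, by simp, fun x hx y hy => ?_⟩
  rw [h2] at hx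
  simp only [Option.mem_def, Option.some.injEq, List.head?_cons] at hx hy
  rw [← hx, ← hy]
  exact hβ

theorem mem_pathEdges_cons {a : Ω} {p : List Ω} {t : Ω × Ω} (h : t ∈ pathEdges (a :: p)) :
    t.1 = a ∨ t ∈ pathEdges p := by
  cases p with
  | nil => simp [pathEdges] at h
  | cons b p =>
    simp only [pathEdges, List.tail_cons, List.zip_cons_cons, List.mem_cons] at h
    rcases h with rfl | h
    · exact Or.inl rfl
    · exact Or.inr (by simpa [pathEdges] using h)

theorem mem_pathEdges_concat {b : Ω} {p : List Ω} {t : Ω × Ω} (h : t ∈ pathEdges (p ++ [b])) :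
    t ∈ pathEdges p ∨ t.2 = b := by
  induction p with
  | nil => simp [pathEdges] at h
  | cons a p ih =>
    cases p with
    | nil =>
      simp only [pathEdges, List.cons_append, List.nil_append, List.tail_cons, List.zip_cons_cons,
        List.zip_nil_right, List.mem_singleton] at h
      exact Or.inr (by rw [h])
    | cons c p =>
      simp only [pathEdges, List.cons_append, List.tail_cons, List.zip_cons_cons,
        List.mem_cons] at h ih ⊢
      rcases h with h | h
      · exact Or.inl (Or.inl h)
      · exact (ih h).imp Or.inr id

end Paths

/-! ### Flow between arbitrary states -/

section FlowPaths

variable {V : Type*} {G : SimpleGraph V} {k : ℕ}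
  {g : SinglyFlawedColoring G k → ProperColoring G k}

theorem proxy_of_isProper {α : State G k} (h : IsProper G α.1) : proxy G g α = α := by
  rw [proxy, dif_pos h]

theorem isProper_proxy (α : State G k) : IsProper G (proxy G g α).1 := by
  rw [proxy]
  split_ifs with h
  · exact h
  · exact (g ⟨α.1, α.2.resolve_left h⟩).2

variable [DecidableEq V]

/-- Few colorings are obtained from a given one by recoloring a single vertex. -/
theorem card_le_of_eq_update [Fintype V] {X : Type*} {f : X → V → Fin k}
    (hf : Function.Injective f) (τ : V → Fin k) (h : ∀ x, ∃ v c, f x = Function.update τ v c) :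
    Nat.card X ≤ k * Fintype.card V := by
  choose v c hvc using h
  have hinj : Function.Injective fun x => (c x, v x) := by
    intro x y hxy
    simp only [Prod.mk.injEq] at hxy
    exact hf (by rw [hvc x, hvc y, hxy.1, hxy.2])
  simpa using Nat.card_le_card_of_injective _ hinj

theorem eq_update_of_eq_update {σ τ : V → Fin k} {v : V} {c : Fin k}
    (h : τ = Function.update σ v c) : σ = Function.update τ v (σ v) := by
  rw [h, Function.update_idem, Function.update_eq_self]

theorem IsRepair.card_fiber_le [Fintype V] (hg : IsRepair G g) (τ : ProperColoring G k) :
    Nat.card {σ // g σ = τ} ≤ k * Fintype.card V := by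
  refine card_le_of_eq_update (f := fun σ : {σ // g σ = τ} => σ.1.1)
    (Subtype.val_injective.comp Subtype.val_injective) τ.1 ?_
  rintro ⟨σ, rfl⟩
  obtain ⟨v, c, h⟩ := hg σ
  exact ⟨v, σ.1 v, eq_update_of_eq_update h⟩

theorem IsRepair.proxy_eq_update [Nonempty V] (hg : IsRepair G g) (α : State G k) :
    ∃ v c, (proxy G g α).1 = Function.update α.1 v c := by
  rw [proxy]
  split_ifs with h
  · obtain ⟨v⟩ := ‹Nonempty V›
    exact ⟨v, α.1 v, (Function.update_eq_self _ _).symm⟩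
  · exact hg ⟨α.1, α.2.resolve_left h⟩

variable [Fintype V]

/-- Fibers of the proxy map also contain the proper state itself, but this too is a (trivial)
one-vertex recoloring, so the bound `k * n` still covers the whole fiber. -/
theorem IsRepair.sum_comp_proxy_le [Nonempty V] (hg : IsRepair G g) {f : State G k → ℝ}
    (hf : ∀ σ, 0 ≤ f σ) :
    ∑ α, f (proxy G g α) ≤ (k * Fintype.card V : ℕ) * ∑ a ∈ properStates G k, f a := by
  classical
  rw [← Finset.sum_fiberwise_of_maps_to' (t := properStates G k) (g := proxy G g)
    (fun α _ => mem_properStates.2 (isProper_proxy α)), Finset.mul_sum]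
  refine Finset.sum_le_sum fun a _ => ?_
  rw [Finset.sum_const, nsmul_eq_mul]
  refine mul_le_mul_of_nonneg_right ?_ (hf a)
  have h := card_le_of_eq_update (X := {α : State G k // proxy G g α = a})
    (f := fun α => α.1.1) (Subtype.val_injective.comp Subtype.val_injective) a.1 (by
      rintro ⟨α, rfl⟩
      obtain ⟨v, c, h⟩ := hg.proxy_eq_update α
      exact ⟨v, α.1 v, eq_update_of_eq_update h⟩)
  rw [Nat.card_eq_fintype_card, Fintype.card_subtype] at h
  exact_mod_cast h

open Classical in
theorem sum_flowPaths (L : LinOrd V) (α β : State G k) (F : List (State G k) → ℝ) :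
    ∑ p ∈ flowPaths G L g α β, F p =
      ∑ p ∈ stepPaths G (proxy G g β) (schedule G L) (proxy G g α),
        F ((if IsProper G α.1 then [] else [α]) ++ p ++
          (if IsProper G β.1 then [] else [β])) := by
  rw [flowPaths, Finset.sum_image]
  intro p _ q _ h
  exact List.append_cancel_left (List.append_cancel_right h)

open Classical in
theorem splitFlow_append (π : State G k → ℝ) (L : LinOrd V) (α β σ τ : State G k)
    {p : List (State G k)} (hp : p ∈ stepPaths G τ (schedule G L) σ) :
    splitFlow G π L α β ((if IsProper G α.1 then [] else [α]) ++ p ++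
        (if IsProper G β.1 then [] else [β])) =
      π α * π β * splitWeight G (schedule G L) p := by
  have hlen : (schedule G L).length ≤ p.length := by
    rw [length_of_mem_stepPaths hp]
    exact Nat.le_succ _
  rw [splitFlow]
  by_cases hα : IsProper G α.1
  · rw [if_pos hα, if_pos hα, List.nil_append, splitWeight_append hlen]
  · rw [if_neg hα, if_neg hα, List.singleton_append, List.cons_append, List.tail_cons,
      splitWeight_append hlen]

theorem isPath_of_mem_flowPaths [Nonempty V] (hg : IsRepair G g) (L : LinOrd V)
    {α β : State G k} {p : List (State G k)} (hp : p ∈ flowPaths G L g α β) :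
    IsPath (transition G k) α β p := by
  classical
  rw [flowPaths, Finset.mem_image] at hp
  obtain ⟨q, hq, rfl⟩ := hp
  have h0 : IsPath (transition G k) (proxy G g α) (proxy G g β) q := by
    obtain ⟨τ, hτ, rfl⟩ := (isSafe_schedule L (isProper_proxy (g := g) α)
      (isProper_proxy (g := g) β)).exists_getLast hq
    refine ⟨?_, hτ, isChain_of_mem_stepPaths hq⟩
    obtain ⟨r, rfl⟩ := stepPaths_head hq
    rfl
  have h1 : IsPath (transition G k) α (proxy G g β)
      ((if IsProper G α.1 then [] else [α]) ++ q) := by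
    split_ifs with hα
    · rwa [proxy_of_isProper hα] at h0
    · obtain ⟨v, c, h⟩ := hg.proxy_eq_update α
      exact h0.cons (transition_pos_of_eq_update h)
  by_cases hβ : IsProper G β.1
  · rw [if_pos hβ, List.append_nil]
    rwa [proxy_of_isProper hβ] at h1
  · rw [if_neg hβ]
    obtain ⟨v, c, h⟩ := hg.proxy_eq_update β
    exact h1.concat (transition_pos_of_eq_update (eq_update_of_eq_update h))

theorem isFlow_splitFlow [Nonempty V] [DecidableRel G.Adj] (hk : G.maxDegree < k)
    (hg : IsRepair G g) (L : LinOrd V) {π : State G k → ℝ} (hπ : ∀ σ, 0 ≤ π σ) :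
    IsFlow (transition G k) π (flowPaths G L g) (splitFlow G π L) := by
  classical
  refine ⟨fun α β p hp => isPath_of_mem_flowPaths hg L hp, fun α β p _ =>
    mul_nonneg (mul_nonneg (hπ α) (hπ β)) (splitWeight_nonneg _ _), fun α β => ?_⟩
  rw [sum_flowPaths, Finset.sum_congr rfl fun p hp => splitFlow_append π L α β _ _ hp,
    ← Finset.mul_sum, (isSafe_schedule L (isProper_proxy α) (isProper_proxy β)).sum_splitWeight hk,
    mul_one]

/-- With `π` replaced by the constant `1`, the flow from `α` to `β` totals `1`, so some path carries
it. That it is a flow needs only nonnegative weights, so there is no circularity with stationarity.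
-/
theorem reflTransGen_transition [Nonempty V] [DecidableRel G.Adj] (hk : G.maxDegree < k)
    (α β : State G k) :
    Relation.ReflTransGen (fun σ τ => 0 < transition G k σ τ) α β := by
  obtain ⟨g, hg⟩ := exists_isRepair (G := G) hk
  have h := (isFlow_splitFlow hk hg (Fintype.equivFin V) (π := fun _ => 1)
    fun _ => zero_le_one).2.2 α β
  obtain ⟨p, hp, -⟩ := Finset.exists_ne_zero_of_sum_ne_zero (h.trans_ne (by norm_num))
  exact (isPath_of_mem_flowPaths hg _ hp).reflTransGen

theorem IsStationary.eq_inv_card_state [Nonempty V] [DecidableRel G.Adj] (hk : G.maxDegree < k)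
    {π : State G k → ℝ} (hπ : IsStationary (transition G k) π) (σ : State G k) :
    π σ = (Fintype.card (State G k) : ℝ)⁻¹ :=
  hπ.eq_inv_card (transition_nonneg G) (sum_transition G (by omega)) (transition_symm G)
    (reflTransGen_transition hk) σ

open Classical in
/-- The flow through `t`, weighted by path lengths, between two given states. -/
theorem sum_flowPaths_filter_le {π : State G k → ℝ} (hπ : ∀ σ, 0 ≤ π σ) (L : LinOrd V)
    (t : State G k × State G k) (α β : State G k) :
    ∑ p ∈ (flowPaths G L g α β).filter (fun p => t ∈ pathEdges p),
        splitFlow G π L α β p * ((p.length : ℝ) - 1) ≤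
      π α * π β * (((schedule G L).length : ℝ) + 2) *
        ((if t.1 = α then 1 else 0) + (if t.2 = β then 1 else 0) +
          ∑ p ∈ (stepPaths G (proxy G g β) (schedule G L) (proxy G g α)).filter
            (fun p => t ∈ pathEdges p), splitWeight G (schedule G L) p) := by
  set X := stepPaths G (proxy G g β) (schedule G L) (proxy G g α)
  have key : ∀ p ∈ X,
      (if t ∈ pathEdges ((if IsProper G α.1 then [] else [α]) ++ p ++
          (if IsProper G β.1 then [] else [β])) then
        splitFlow G π L α β ((if IsProper G α.1 then [] else [α]) ++ p ++
          (if IsProper G β.1 then [] else [β])) *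
        ((((if IsProper G α.1 then [] else [α]) ++ p ++
          (if IsProper G β.1 then [] else [β])).length : ℝ) - 1) else 0) ≤
      π α * π β * (((schedule G L).length : ℝ) + 2) *
        (((if t.1 = α then 1 else 0) + (if t.2 = β then 1 else 0)) *
          splitWeight G (schedule G L) p +
          (if t ∈ pathEdges p then splitWeight G (schedule G L) p else 0)) := by
    intro p hp
    rw [splitFlow_append π L α β _ _ hp]
    have hw := splitWeight_nonneg (schedule G L) p
    have hππ : 0 ≤ π α * π β := mul_nonneg (hπ α) (hπ β)
    have hlen := length_of_mem_stepPaths hp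
    have hrhs : 0 ≤ ((if t.1 = α then (1 : ℝ) else 0) + (if t.2 = β then 1 else 0)) *
        splitWeight G (schedule G L) p +
        (if t ∈ pathEdges p then splitWeight G (schedule G L) p else 0) :=
      add_nonneg (mul_nonneg (by positivity) hw) (by split_ifs <;> [exact hw; exact le_rfl])
    have hpre : (if IsProper G α.1 then [] else [α]) = [] ∨
        (if IsProper G α.1 then [] else [α]) = [α] := by
      split_ifs <;> simp
    have hpost : (if IsProper G β.1 then [] else [β]) = [] ∨
        (if IsProper G β.1 then [] else [β]) = [β] := by
      split_ifs <;> simp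
    generalize (if IsProper G α.1 then [] else [α]) = pre at hpre ⊢
    generalize (if IsProper G β.1 then [] else [β]) = post at hpost ⊢
    by_cases ht : t ∈ pathEdges (pre ++ p ++ post)
    swap
    · rw [if_neg ht]
      exact mul_nonneg (mul_nonneg hππ (by positivity)) hrhs
    rw [if_pos ht]
    -- A canonical path has one state more than steps; the two optional endpoints add at most two
    -- edges.
    have hlen' : ((pre ++ p ++ post).length : ℝ) - 1 ≤ ((schedule G L).length : ℝ) + 2 := by
      have : (pre ++ p ++ post).length ≤ (schedule G L).length + 3 := by
        rw [List.length_append, List.length_append, hlen]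
        rcases hpre with rfl | rfl <;> rcases hpost with rfl | rfl <;> simp <;> omega
      have : ((pre ++ p ++ post).length : ℝ) ≤ (schedule G L).length + 3 := by
        exact_mod_cast this
      linarith
    -- The transition is the first repair edge, the last one, or an edge of the canonical path.
    have hmem : t.1 = α ∨ t.2 = β ∨ t ∈ pathEdges p := by
      have h1 : t ∈ pathEdges (pre ++ p) ∨ t.2 = β := by
        rcases hpost with rfl | rfl
        · exact Or.inl (by simpa using ht)
        · exact mem_pathEdges_concat ht
      rcases h1 with h1 | h1
      · rcases hpre with rfl | rfl
        · exact Or.inr (Or.inr h1)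
        · exact (mem_pathEdges_cons h1).imp_right Or.inr
      · exact Or.inr (Or.inl h1)
    have hone : splitWeight G (schedule G L) p ≤
        ((if t.1 = α then (1 : ℝ) else 0) + (if t.2 = β then 1 else 0)) *
        splitWeight G (schedule G L) p +
        (if t ∈ pathEdges p then splitWeight G (schedule G L) p else 0) := by
      rcases hmem with h | h | h <;> rw [if_pos h] <;> split_ifs <;> linarith
    calc _ ≤ π α * π β * splitWeight G (schedule G L) p * (((schedule G L).length : ℝ) + 2) :=
          mul_le_mul_of_nonneg_left hlen' (mul_nonneg hππ hw)
      _ = π α * π β * (((schedule G L).length : ℝ) + 2) * splitWeight G (schedule G L) p := by ring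
      _ ≤ _ := mul_le_mul_of_nonneg_left hone (mul_nonneg hππ (by positivity))
  rw [Finset.sum_filter, sum_flowPaths]
  refine (Finset.sum_le_sum key).trans ?_
  rw [← Finset.mul_sum, Finset.sum_add_distrib, ← Finset.mul_sum, ← Finset.sum_filter]
  have hππ : 0 ≤ π α * π β := mul_nonneg (hπ α) (hπ β)
  gcongr
  exact mul_le_of_le_one_right (by positivity) (sum_splitWeight_le_one _ _ _)

open Classical in
theorem sum_splitWeight_le [DecidableRel G.Adj] (hk : G.maxDegree < k) (L : LinOrd V)
    (t : State G k × State G k) :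
    ∑ a ∈ properStates G k, ∑ b ∈ properStates G k,
        ∑ p ∈ (stepPaths G b (schedule G L) a).filter (fun p => t ∈ pathEdges p),
          splitWeight G (schedule G L) p ≤
      (Finset.univ.filter fun i : Fin (schedule G L).length =>
        ((schedule G L).get i).Compatible t).card * ((properStates G k).card *
        ((k : ℝ) / ((k - G.maxDegree : ℕ) : ℝ)) ^ (2 * vsnOrder G L)) := by
  rw [← Finset.sum_product']
  calc _ ≤ ∑ x ∈ properStates G k ×ˢ properStates G k, ∑ i : Fin (schedule G L).length,
        if ((schedule G L).get i).Compatible t then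
          reach x.2 ((schedule G L).take i) x.1 t.1 else 0 :=
        Finset.sum_le_sum fun x _ => sum_splitWeight_filter_le
          (one_le_card_stepColors hk) _ _ _ _
    _ = ∑ i ∈ Finset.univ.filter fun i : Fin (schedule G L).length =>
        ((schedule G L).get i).Compatible t, ∑ x ∈ properStates G k ×ˢ properStates G k,
          reach x.2 ((schedule G L).take i) x.1 t.1 := by
        rw [Finset.sum_comm, Finset.sum_filter]
        refine Finset.sum_congr rfl fun i _ => ?_
        split_ifs <;> simp
    _ ≤ _ := by
        rw [← nsmul_eq_mul]
        exact Finset.sum_le_card_nsmul _ _ _ fun i _ => sum_reach_le hk L i t.1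

end FlowPaths

/-! ### Bounding the congestion -/

section Congestion

variable {V : Type*} [Fintype V] [DecidableEq V] {G : SimpleGraph V} {k : ℕ}

theorem IsRepair.sum_sum_comp_proxy_le [Nonempty V]
    {g : SinglyFlawedColoring G k → ProperColoring G k} (hg : IsRepair G g)
    {h : State G k → State G k → ℝ} (hh : ∀ a b, 0 ≤ h a b) :
    ∑ α, ∑ β, h (proxy G g α) (proxy G g β) ≤
      ((k * Fintype.card V : ℕ) : ℝ) ^ 2 *
        ∑ a ∈ properStates G k, ∑ b ∈ properStates G k, h a b := by
  calc ∑ α, ∑ β, h (proxy G g α) (proxy G g β)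
      ≤ ((k * Fintype.card V : ℕ) : ℝ) * ∑ a ∈ properStates G k, ∑ β, h a (proxy G g β) :=
        hg.sum_comp_proxy_le (f := fun a => ∑ β, h a (proxy G g β))
          fun a => Finset.sum_nonneg fun β _ => hh _ _
    _ ≤ ((k * Fintype.card V : ℕ) : ℝ) * ∑ a ∈ properStates G k,
          ((k * Fintype.card V : ℕ) : ℝ) * ∑ b ∈ properStates G k, h a b := by
        refine mul_le_mul_of_nonneg_left (Finset.sum_le_sum fun a _ => ?_) (by positivity)
        exact hg.sum_comp_proxy_le (hh a)
    _ = _ := by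
        rw [← Finset.mul_sum]
        ring

open Classical in
theorem sum_sum_proxy_le [Nonempty V] [DecidableRel G.Adj] (hk : G.maxDegree < k)
    {g : SinglyFlawedColoring G k → ProperColoring G k} (hg : IsRepair G g) (L : LinOrd V)
    (t : State G k × State G k) {K : ℕ}
    (hK : (Finset.univ.filter fun i : Fin (schedule G L).length =>
      ((schedule G L).get i).Compatible t).card ≤ K) :
    ∑ α, ∑ β, ∑ p ∈ (stepPaths G (proxy G g β) (schedule G L) (proxy G g α)).filter
        (fun p => t ∈ pathEdges p), splitWeight G (schedule G L) p ≤
      ((k * Fintype.card V : ℕ) : ℝ) ^ 2 * (K * (Fintype.card (State G k) *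
        ((k : ℝ) / ((k - G.maxDegree : ℕ) : ℝ)) ^ (2 * vsnOrder G L))) := by
  refine (hg.sum_sum_comp_proxy_le (h := fun a b => ∑ p ∈ (stepPaths G b (schedule G L) a).filter
    (fun p => t ∈ pathEdges p), splitWeight G (schedule G L) p) fun a b =>
    Finset.sum_nonneg fun p _ => splitWeight_nonneg _ _).trans ?_
  refine mul_le_mul_of_nonneg_left ((sum_splitWeight_le hk L t).trans ?_) (by positivity)
  have hcard : ((properStates G k).card : ℝ) ≤ Fintype.card (State G k) := by
    exact_mod_cast Finset.card_le_univ _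
  have hKR : ((Finset.univ.filter fun i : Fin (schedule G L).length =>
      ((schedule G L).get i).Compatible t).card : ℝ) ≤ K := by exact_mod_cast hK
  exact mul_le_mul hKR (mul_le_mul_of_nonneg_right hcard (by positivity)) (by positivity)
    (by positivity)

open Classical in
-- Under the uniform distribution all powers of the number of states cancel. The number `K` of
-- compatible steps stays a parameter because loops and genuine moves are balanced differently
-- against the transition probability.
theorem congestion_le_card_compatible [Nonempty V] [DecidableRel G.Adj] (hk : G.maxDegree < k)
    {g : SinglyFlawedColoring G k → ProperColoring G k} (hg : IsRepair G g) (L : LinOrd V)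
    {π : State G k → ℝ} (hπ : IsStationary (transition G k) π) (t : State G k × State G k)
    {K : ℕ} (hK : (Finset.univ.filter fun i : Fin (schedule G L).length =>
      ((schedule G L).get i).Compatible t).card ≤ K) :
    congestion (transition G k) π (flowPaths G L g) (splitFlow G π L) t ≤
      1 / transition G k t.1 t.2 * (((schedule G L).length : ℝ) + 2) *
        (2 + ((k * Fintype.card V : ℕ) : ℝ) ^ 2 *
          (K * ((k : ℝ) / ((k - G.maxDegree : ℕ) : ℝ)) ^ (2 * vsnOrder G L))) := by
  have hsum := sum_sum_proxy_le hk hg L t hK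
  have hunif := hπ.eq_inv_card_state hk
  have hpair := fun α β => sum_flowPaths_filter_le (g := g) hπ.1 L t α β
  have : Nonempty (State G k) := ⟨t.1⟩
  have hN : 0 < (Fintype.card (State G k) : ℝ) := by exact_mod_cast Fintype.card_pos
  have hP := transition_nonneg G t.1 t.2
  have hM : (0 : ℝ) ≤ ((schedule G L).length : ℝ) + 2 := by positivity
  simp only [hunif] at hpair
  rw [congestion, hunif t.1]
  -- Pairs for which `t` can be a repair edge: `N` with `α = t.1` and `N` with `β = t.2`. This is
  -- the source of the summand `2`.
  have hdbl : ∑ α : State G k, ∑ β : State G k,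
      ((if t.1 = α then (1 : ℝ) else 0) + (if t.2 = β then 1 else 0)) =
      Fintype.card (State G k) + Fintype.card (State G k) := by
    simp [Finset.sum_add_distrib]
  generalize ((schedule G L).length : ℝ) + 2 = M at hpair hM ⊢
  generalize ((k : ℝ) / ((k - G.maxDegree : ℕ) : ℝ)) ^ (2 * vsnOrder G L) = B at hsum ⊢
  generalize ((k * Fintype.card V : ℕ) : ℝ) = q at hsum ⊢
  generalize transition G k t.1 t.2 = T at hP ⊢
  generalize (Fintype.card (State G k) : ℝ) = N at hsum hpair hN hdbl ⊢
  have htot := Finset.sum_le_sum fun α (_ : α ∈ Finset.univ) =>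
    Finset.sum_le_sum fun β (_ : β ∈ Finset.univ) => hpair α β
  simp only [← Finset.mul_sum, Finset.sum_add_distrib (g := fun β => Finset.sum _ _)] at htot
  rw [hdbl] at htot
  have hfin : N⁻¹ * N⁻¹ * M * (N + N + q ^ 2 * (K * (N * B))) =
      N⁻¹ * M * (2 + q ^ 2 * (K * B)) := by
    field_simp
    ring
  have hle := htot.trans (mul_le_mul_of_nonneg_left (add_le_add_right hsum (N + N))
    (mul_nonneg (by positivity) hM))
  rw [hfin] at hle
  have hc : 0 ≤ 1 / (N⁻¹ * T) := by positivity
  have heq : 1 / (N⁻¹ * T) * (N⁻¹ * M * (2 + q ^ 2 * (K * B))) =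
      1 / T * M * (2 + q ^ 2 * (K * B)) := by
    rw [one_div, one_div, mul_inv, inv_inv]
    calc N * T⁻¹ * (N⁻¹ * M * (2 + q ^ 2 * (K * B)))
        = (N * N⁻¹) * (T⁻¹ * M * (2 + q ^ 2 * (K * B))) := by ring
      _ = _ := by rw [mul_inv_cancel₀ hN.ne', one_mul]
  have hle' := mul_le_mul_of_nonneg_left hle hc
  rw [heq] at hle'
  refine le_trans (le_of_eq ?_) hle'
  congr!

/-- Here `T` stands for the inverse transition probability, `M` bounds path lengths, `K` counts
compatible steps, `s` is the separation number and `B` the encoding factor. The constant is `8 = 3 *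
2 * (4 / 3)`: `M ≤ 3 * n * s`, then `2 * n * k` from `T`, then the repair edges absorbed into a
third of the main term. -/
theorem flow_bound_arith {k n s M K T B : ℝ} (hk : 3 ≤ k) (hn : 2 ≤ n) (hs : 1 ≤ s) (hB : 1 ≤ B)
    (hM0 : 0 ≤ M) (hM : M ≤ n * (1 + s) + 2)
    (hT1 : T ≤ 2 * (n * k)) (hTK : T * K ≤ 2 * (n * k) * n) :
    T * M * (2 + (k * n) ^ 2 * (K * B)) ≤ 8 * s * k ^ 3 * n ^ 5 * B := by
  have h1 : T * (2 + (k * n) ^ 2 * (K * B)) ≤ 2 * (n * k) * (2 + (k * n) ^ 2 * (n * B)) := by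
    have : (k * n) ^ 2 * B * (T * K) ≤ (k * n) ^ 2 * B * (2 * (n * k) * n) := by gcongr
    nlinarith
  have h2 : M ≤ 3 * (n * s) := by nlinarith
  have h3 : (72 : ℝ) ≤ k ^ 2 * n ^ 3 * B := by
    calc (72 : ℝ) = 3 ^ 2 * 2 ^ 3 * 1 := by norm_num
      _ ≤ k ^ 2 * n ^ 3 * B := by gcongr
  calc T * M * (2 + (k * n) ^ 2 * (K * B)) = M * (T * (2 + (k * n) ^ 2 * (K * B))) := by ring
    _ ≤ M * (2 * (n * k) * (2 + (k * n) ^ 2 * (n * B))) := mul_le_mul_of_nonneg_left h1 hM0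
    _ ≤ 3 * (n * s) * (2 * (n * k) * (2 + (k * n) ^ 2 * (n * B))) := by gcongr
    _ = 6 * n ^ 2 * k * s * (2 + k ^ 2 * n ^ 3 * B) := by ring
    _ ≤ 6 * n ^ 2 * k * s * (4 / 3 * (k ^ 2 * n ^ 3 * B)) := by
        gcongr
        linarith
    _ = _ := by ring

theorem congestion_le [Nonempty V] [DecidableRel G.Adj] (hΔ : 1 ≤ G.maxDegree)
    (hk : G.maxDegree + 2 ≤ k)
    {g : SinglyFlawedColoring G k → ProperColoring G k} (hg : IsRepair G g) (L : LinOrd V)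
    {π : State G k → ℝ} (hπ : IsStationary (transition G k) π) {t : State G k × State G k}
    (ht : 0 < transition G k t.1 t.2) :
    congestion (transition G k) π (flowPaths G L g) (splitFlow G π L) t ≤
      8 * (vsnOrder G L : ℝ) * (k : ℝ) ^ 3 * (Fintype.card V : ℝ) ^ 5 *
        ((k : ℝ) / ((k - G.maxDegree : ℕ) : ℝ)) ^ (2 * vsnOrder G L) := by
  classical
  obtain ⟨a, ha⟩ := G.exists_maximal_degree_vertex
  obtain ⟨b, hab⟩ : ∃ b, G.Adj a b := (G.degree_pos_iff_exists_adj a).1 (by omega)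
  have hs : 1 ≤ vsnOrder G L := vsnOrder_pos G L hab
  have hsn := vsnOrder_le_card G L
  have hn : 2 ≤ Fintype.card V := Fintype.one_lt_card_iff.2 ⟨a, b, hab.ne⟩
  have hlen := length_schedule_le G L
  have hd0 : (0 : ℝ) < ((k - G.maxDegree : ℕ) : ℝ) := by exact_mod_cast (by omega)
  have hB : 1 ≤ ((k : ℝ) / ((k - G.maxDegree : ℕ) : ℝ)) ^ (2 * vsnOrder G L) := by
    refine one_le_pow₀ ((one_le_div hd0).2 ?_)
    exact_mod_cast Nat.sub_le _ _
  have hK : t.1 ≠ t.2 → (Finset.univ.filter fun i : Fin (schedule G L).length =>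
      ((schedule G L).get i).Compatible t).card ≤ Fintype.card V :=
    fun hne => card_compatible_le hne L
  have hK' : (Finset.univ.filter fun i : Fin (schedule G L).length =>
      ((schedule G L).get i).Compatible t).card ≤ (schedule G L).length := by
    simpa using Finset.card_le_univ (Finset.univ.filter fun i : Fin (schedule G L).length =>
      ((schedule G L).get i).Compatible t)
  refine (congestion_le_card_compatible (by omega) hg L hπ t le_rfl).trans ?_
  generalize (Finset.univ.filter fun i : Fin (schedule G L).length =>
    ((schedule G L).get i).Compatible t).card = K at hK hK' ⊢
  have hk3 : (3 : ℝ) ≤ k := by exact_mod_cast (by omega : 3 ≤ k)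
  have hn2 : (2 : ℝ) ≤ (Fintype.card V : ℝ) := by exact_mod_cast hn
  have hs1 : (1 : ℝ) ≤ (vsnOrder G L : ℝ) := by exact_mod_cast hs
  have hsn' : (vsnOrder G L : ℝ) ≤ Fintype.card V := by exact_mod_cast hsn
  have hlen' : ((schedule G L).length : ℝ) ≤ Fintype.card V * (1 + vsnOrder G L) := by
    exact_mod_cast hlen
  have hKlen : (K : ℝ) ≤ Fintype.card V * (1 + vsnOrder G L) :=
    le_trans (by exact_mod_cast hK') hlen'
  have hloop : t.1 = t.2 → 1 / transition G k t.1 t.2 ≤ 2 := by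
    intro he
    rw [div_le_iff₀ ht, he]
    have := half_le_transition_self G t.2
    linarith
  have hmove : t.1 ≠ t.2 → 1 / transition G k t.1 t.2 ≤ 2 * (Fintype.card V * k) := by
    intro hne
    obtain ⟨v, c, h⟩ := exists_eq_update_of_transition_pos (Ne.symm hne) ht
    refine (one_div_le_one_div_of_le (by positivity) (le_transition_of_eq_update h)).trans
      (le_of_eq ?_)
    field_simp
  rw [Nat.cast_mul]
  -- For a loop `T ≤ 2` compensates for up to `n * (1 + s)` compatible steps, as `1 + s ≤ k * n`;
  -- for a move `T ≤ 2 * n * k` and there are at most `n` of them.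
  refine flow_bound_arith hk3 hn2 hs1 hB (by positivity) (by linarith) ?_ ?_
  · by_cases hne : t.1 = t.2
    · exact (hloop hne).trans (by nlinarith)
    · exact hmove hne
  · by_cases hne : t.1 = t.2
    · calc 1 / transition G k t.1 t.2 * (K : ℝ)
          ≤ 2 * (Fintype.card V * (1 + vsnOrder G L)) :=
            mul_le_mul (hloop hne) hKlen (by positivity) (by norm_num)
        _ = 2 * (1 + vsnOrder G L) * Fintype.card V := by ring
        _ ≤ 2 * (Fintype.card V * k) * Fintype.card V := by
          gcongr
          nlinarith
    · exact mul_le_mul (hmove hne) (by exact_mod_cast hK hne) (by positivity) (by positivity)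

end Congestion

end

end SingleFlaw

/-! ### The main theorem -/

theorem mainTheorem3 {V : Type*} [Fintype V] [DecidableEq V] (G : SimpleGraph V)
    [DecidableRel G.Adj] (ε : ℝ) (hε : 0 < ε)
    (hΔ : (G.maxDegree : ℝ) + 2 ≤ (1 + ε) * (G.maxDegree : ℝ))
    (n k : ℕ) (hn : n = Fintype.card V) (hk : k = SingleFlaw.numColors G ε)
    (lam : ℝ) (hlam : lam = (SingleFlaw.vsn G : ℝ) / Real.log n)
    (π : SingleFlaw.State G k → ℝ)
    (hπ : SingleFlaw.IsStationary (SingleFlaw.transition G k) π) :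
    (∃ L : SingleFlaw.LinOrd V, SingleFlaw.IsMinimalOrder G L) ∧
    (∃ g : SingleFlaw.SinglyFlawedColoring G k → SingleFlaw.ProperColoring G k,
      SingleFlaw.IsRepair G g) ∧
    ∀ L : SingleFlaw.LinOrd V, SingleFlaw.IsMinimalOrder G L →
    ∀ g : SingleFlaw.SinglyFlawedColoring G k → SingleFlaw.ProperColoring G k,
      SingleFlaw.IsRepair G g →
      (∀ τ, Nat.card {σ // g σ = τ} ≤ k * n) ∧
      SingleFlaw.IsFlow (SingleFlaw.transition G k) π
        (SingleFlaw.flowPaths G L g) (SingleFlaw.splitFlow G π L) ∧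
      ∀ t : SingleFlaw.State G k × SingleFlaw.State G k,
        0 < SingleFlaw.transition G k t.1 t.2 →
        SingleFlaw.congestion (SingleFlaw.transition G k) π
            (SingleFlaw.flowPaths G L g) (SingleFlaw.splitFlow G π L) t ≤
          8 * (k : ℝ) ^ 3 * (lam + 1) * (n : ℝ) ^ 5 * Real.log n *
            ((1 + ε) / ε) ^ (2 * SingleFlaw.pathwidth G) ∧
        SingleFlaw.congestion (SingleFlaw.transition G k) π
            (SingleFlaw.flowPaths G L g) (SingleFlaw.splitFlow G π L) t ≤
          8 * (SingleFlaw.pathwidth G : ℝ) * (k : ℝ) ^ 3 * (n : ℝ) ^ 5 *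
            ((1 + ε) / ε) ^ (2 * SingleFlaw.pathwidth G) := by
  have hεΔ : 2 ≤ ε * (G.maxDegree : ℝ) := by linarith
  have hΔ1 : 1 ≤ G.maxDegree := by
    rcases Nat.eq_zero_or_pos G.maxDegree with h | h
    · rw [h] at hεΔ
      norm_num at hεΔ
    · exact h
  have hne : Nonempty V := by
    by_contra h
    rw [not_nonempty_iff] at h
    simp at hΔ1
  have hkceil : (1 + ε) * (G.maxDegree : ℝ) ≤ k := hk ▸ Nat.le_ceil _
  have hk2 : G.maxDegree + 2 ≤ k := by exact_mod_cast hΔ.trans hkceil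
  subst hn
  refine ⟨SingleFlaw.exists_isMinimalOrder G, SingleFlaw.exists_isRepair (by omega),
    fun L hL g hg => ⟨hg.card_fiber_le,
      SingleFlaw.isFlow_splitFlow (by omega) hg L hπ.1, fun t ht => ?_⟩⟩
  have hvsn : SingleFlaw.vsnOrder G L ≤ SingleFlaw.pathwidth G :=
    hL.trans_le (SingleFlaw.vsn_le_pathwidth G)
  have hd : (0 : ℝ) < ((k - G.maxDegree : ℕ) : ℝ) := by exact_mod_cast (by omega)
  -- After cross-multiplication this is exactly `(1 + ε) * Δ ≤ k`.
  have hratio : (k : ℝ) / ((k - G.maxDegree : ℕ) : ℝ) ≤ (1 + ε) / ε := by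
    rw [div_le_div_iff₀ hd hε, Nat.cast_sub (by omega)]
    linarith
  have hR : 1 ≤ (1 + ε) / ε := by
    rw [one_le_div hε]
    linarith
  have hpow : ((k : ℝ) / ((k - G.maxDegree : ℕ) : ℝ)) ^ (2 * SingleFlaw.vsnOrder G L) ≤
      ((1 + ε) / ε) ^ (2 * SingleFlaw.pathwidth G) :=
    (pow_le_pow_left₀ (by positivity) hratio _).trans (pow_le_pow_right₀ hR (by omega))
  have hmain : SingleFlaw.congestion (SingleFlaw.transition G k) π
      (SingleFlaw.flowPaths G L g) (SingleFlaw.splitFlow G π L) t ≤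
      8 * (SingleFlaw.vsnOrder G L : ℝ) * (k : ℝ) ^ 3 * (Fintype.card V : ℝ) ^ 5 *
        ((1 + ε) / ε) ^ (2 * SingleFlaw.pathwidth G) :=
    (SingleFlaw.congestion_le hΔ1 hk2 hg L hπ ht).trans (by gcongr)
  constructor
  · refine hmain.trans ?_
    -- Positivity makes `lam * log n` equal to the vertex separation number; the `+ 1` is slack.
    have hlog : 0 < Real.log (Fintype.card V) := by
      refine Real.log_pos ?_
      have h1 := (G.exists_maximal_degree_vertex).choose_spec
      have h2 := G.degree_lt_card_verts (G.exists_maximal_degree_vertex).choose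
      exact_mod_cast (by omega : 1 < Fintype.card V)
    have hlam' : (SingleFlaw.vsnOrder G L : ℝ) ≤ (lam + 1) * Real.log (Fintype.card V) := by
      rw [hlam, add_mul, div_mul_cancel₀ _ hlog.ne', hL]
      linarith
    calc _ = 8 * (k : ℝ) ^ 3 * (Fintype.card V : ℝ) ^ 5 *
          ((1 + ε) / ε) ^ (2 * SingleFlaw.pathwidth G) * (SingleFlaw.vsnOrder G L : ℝ) := by ring
      _ ≤ 8 * (k : ℝ) ^ 3 * (Fintype.card V : ℝ) ^ 5 *
          ((1 + ε) / ε) ^ (2 * SingleFlaw.pathwidth G) *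
          ((lam + 1) * Real.log (Fintype.card V)) := by gcongr
      _ = _ := by ring
  · refine hmain.trans ?_
    gcongr
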